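/- Let $(M,g)$ be a space-time, i.e. a smooth Hausdorff second countable manifold of dimension $n+1$ with a smooth Lorentzian metric $g$ of signature $(-,+,\dots,+)$ and a time orientation. For $p\in M$ let $J^-(p)$ (resp. $J^+(p)$) be the set consisting of $p$ and of all points $x$ for which there is a future directed causal curve from $x$ to $p$ (resp. from $p$ to $x$), and for $S\subseteq M$ let $J^+(S)=\bigcup_{x\in S}J^+(x)$. Let $D^+(S)$ (resp. $D^-(S)$) be the set of all points $x$ such that every past (resp. future) inextendible causal curve starting at $x$ and running to the past (resp. future) meets $S$. Assume that $(M,g)$ is globally hyperbolic with a smooth Cauchy hypersurface $\Sigma$, i.e. $\Sigma$ is a closed achronal set (no two points of $\Sigma$, equal or not, are joined by a timelike curve) which is a smooth embedded hypersurface of $M$, and $D^+(\Sigma)\cup D^-(\Sigma)=M$. Let $U\subseteq M$ be open and let $q\in M$ be a point with $J^+(\Sigma)\cap J^-(q)\subseteq U$. Then for every sequence $(q_i)$ of points of $M$ with $q_i\to q$ there is $i_0$ such that $$J^+(\Sigma)\cap J^-(q_i)\subseteq U\qquad\text{for all } i\ge i_0 .$$ -/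

import Mathlib

open Set Filter MeasureTheory
open scoped Manifold ContDiff Topology

namespace LorentzGeometry

section Metric

variable (n : ℕ) (M : Type*) [TopologicalSpace M]
  [ChartedSpace (EuclideanSpace ℝ (Fin (n + 1))) M] [IsManifold (𝓡 (n + 1)) ∞ M]

/-- A smooth Lorentzian metric on a manifold of dimension `n + 1`: a smooth symmetric covariant
2-tensor field of signature `(-, +, …, +)` at every point. The signature is expressed by the
existence of a vector of negative square on whose orthogonal complement the form is positive
definite. -/
structure LorentzianMetric where
  /-- The bilinear form on the tangent space at `x`. -/
  val (x : M) : TangentSpace (𝓡 (n + 1)) x →L[ℝ] TangentSpace (𝓡 (n + 1)) x →L[ℝ] ℝ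
  symm (x : M) (v w : TangentSpace (𝓡 (n + 1)) x) : val x v w = val x w v
  signature (x : M) : ∃ v : TangentSpace (𝓡 (n + 1)) x, val x v v < 0 ∧
    ∀ w : TangentSpace (𝓡 (n + 1)) x, val x v w = 0 → w ≠ 0 → 0 < val x w w
  smooth : ContMDiff (𝓡 (n + 1))
    ((𝓡 (n + 1)).prod 𝓘(ℝ, EuclideanSpace ℝ (Fin (n + 1)) →L[ℝ]
      EuclideanSpace ℝ (Fin (n + 1)) →L[ℝ] ℝ)) ∞
    (fun x ↦ Bundle.TotalSpace.mk' (EuclideanSpace ℝ (Fin (n + 1)) →L[ℝ]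
      EuclideanSpace ℝ (Fin (n + 1)) →L[ℝ] ℝ) x (val x))

variable {n M}

/-- A time orientation, given by a continuous timelike vector field, which is declared to be
future directed. -/
structure TimeOrientation (g : LorentzianMetric n M) where
  /-- The timelike vector field. -/
  field (x : M) : TangentSpace (𝓡 (n + 1)) x
  timelike (x : M) : g.val x (field x) (field x) < 0
  continuous : Continuous
    (fun x ↦ (⟨x, field x⟩ : TangentBundle (𝓡 (n + 1)) M))

end Metric

section Causality

variable {n : ℕ} {M : Type*} [TopologicalSpace M]
  [ChartedSpace (EuclideanSpace ℝ (Fin (n + 1))) M] [IsManifold (𝓡 (n + 1)) ∞ M]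
  {g : LorentzianMetric n M}

/-- `v` is a future directed timelike vector at `x`. -/
def IsFutureTimelike (T : TimeOrientation g) (x : M) (v : TangentSpace (𝓡 (n + 1)) x) : Prop :=
  g.val x v v < 0 ∧ g.val x (T.field x) v < 0

/-- `v` is a future directed causal (timelike or null, nonzero) vector at `x`. -/
def IsFutureCausal (T : TimeOrientation g) (x : M) (v : TangentSpace (𝓡 (n + 1)) x) : Prop :=
  v ≠ 0 ∧ g.val x v v ≤ 0 ∧ g.val x (T.field x) v < 0

/-- `v` is a past directed causal vector at `x`. -/
def IsPastCausal (T : TimeOrientation g) (x : M) (v : TangentSpace (𝓡 (n + 1)) x) : Prop :=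
  v ≠ 0 ∧ g.val x v v ≤ 0 ∧ 0 < g.val x (T.field x) v

variable (n) in
/-- The curve `γ` is continuous and locally Lipschitz on `s`; the Lipschitz condition is read in
a chart around each point of the curve (any two charts give the same notion). -/
def IsLocallyLipschitzCurveOn (γ : ℝ → M) (s : Set ℝ) : Prop :=
  ContinuousOn γ s ∧ ∀ t ∈ s, ∃ K, ∃ u ∈ 𝓝[s] t,
    LipschitzOnWith K (fun τ ↦ extChartAt (𝓡 (n + 1)) (γ t) (γ τ)) u

/-- `γ` restricted to the interval `s` is a future directed causal curve: it is locally Lipschitz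
and its tangent vector, which exists almost everywhere, is almost everywhere future directed
causal. Up to parametrization these are the continuous future directed causal curves. -/
def IsFutureCausalCurveOn (T : TimeOrientation g) (γ : ℝ → M) (s : Set ℝ) : Prop :=
  IsLocallyLipschitzCurveOn n γ s ∧
    ∀ᵐ t ∂(volume.restrict s), MDifferentiableAt 𝓘(ℝ, ℝ) (𝓡 (n + 1)) γ t ∧
      IsFutureCausal T (γ t) (mfderiv 𝓘(ℝ, ℝ) (𝓡 (n + 1)) γ t (1 : ℝ))

/-- `γ` restricted to the interval `s` is a past directed causal curve. -/
def IsPastCausalCurveOn (T : TimeOrientation g) (γ : ℝ → M) (s : Set ℝ) : Prop :=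
  IsLocallyLipschitzCurveOn n γ s ∧
    ∀ᵐ t ∂(volume.restrict s), MDifferentiableAt 𝓘(ℝ, ℝ) (𝓡 (n + 1)) γ t ∧
      IsPastCausal T (γ t) (mfderiv 𝓘(ℝ, ℝ) (𝓡 (n + 1)) γ t (1 : ℝ))

/-- `γ` restricted to the interval `s` is a smooth future directed timelike curve. -/
def IsSmoothFutureTimelikeCurveOn (T : TimeOrientation g) (γ : ℝ → M) (s : Set ℝ) : Prop :=
  ContMDiffOn 𝓘(ℝ, ℝ) (𝓡 (n + 1)) ∞ γ s ∧
    ∀ t ∈ s, IsFutureTimelike T (γ t) (mfderivWithin 𝓘(ℝ, ℝ) (𝓡 (n + 1)) γ s t (1 : ℝ))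

/-- `x` causally precedes `y`: either `x = y`, or there is a future directed causal curve
from `x` to `y`. -/
def CausallyPrecedes (T : TimeOrientation g) (x y : M) : Prop :=
  x = y ∨ ∃ (a b : ℝ) (γ : ℝ → M), a < b ∧ γ a = x ∧ γ b = y ∧
    IsFutureCausalCurveOn T γ (Icc a b)

/-- `x` chronologically precedes `y`: there is a future directed timelike curve from `x` to `y`
that is piecewise smooth, that is, a finite (nonempty) concatenation of smooth ones. -/
def ChronologicallyPrecedes (T : TimeOrientation g) : M → M → Prop :=
  Relation.TransGen fun x y ↦ ∃ (a b : ℝ) (γ : ℝ → M), a < b ∧ γ a = x ∧ γ b = y ∧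
    IsSmoothFutureTimelikeCurveOn T γ (Icc a b)

/-- The causal past `J⁻(p)` of a point. -/
def causalPast (T : TimeOrientation g) (p : M) : Set M := {x | CausallyPrecedes T x p}

/-- The causal future `J⁺(p)` of a point. -/
def causalFuture (T : TimeOrientation g) (p : M) : Set M := {x | CausallyPrecedes T p x}

/-- The causal future `J⁺(S)` of a set. -/
def causalFutureSet (T : TimeOrientation g) (S : Set M) : Set M := ⋃ x ∈ S, causalFuture T x

/-- A past inextendible past directed causal curve starting at `x`: it has no past endpoint, that
is, no limit point towards its open end. The half-open parameter interval is normalized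
to `[0, ∞)`. -/
def IsPastInextendibleCausalCurveFrom (T : TimeOrientation g) (x : M) (γ : ℝ → M) : Prop :=
  γ 0 = x ∧ IsPastCausalCurveOn T γ (Ici 0) ∧ ¬ ∃ y, Tendsto γ atTop (𝓝 y)

/-- A future inextendible future directed causal curve starting at `x`. -/
def IsFutureInextendibleCausalCurveFrom (T : TimeOrientation g) (x : M) (γ : ℝ → M) : Prop :=
  γ 0 = x ∧ IsFutureCausalCurveOn T γ (Ici 0) ∧ ¬ ∃ y, Tendsto γ atTop (𝓝 y)

/-- The future Cauchy development `D⁺(S)`: every past inextendible causal curve from the point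
meets `S`. -/
def futureCauchyDevelopment (T : TimeOrientation g) (S : Set M) : Set M :=
  {x | ∀ γ, IsPastInextendibleCausalCurveFrom T x γ → ∃ t, 0 ≤ t ∧ γ t ∈ S}

/-- The past Cauchy development `D⁻(S)`: every future inextendible causal curve from the point
meets `S`. -/
def pastCauchyDevelopment (T : TimeOrientation g) (S : Set M) : Set M :=
  {x | ∀ γ, IsFutureInextendibleCausalCurveFrom T x γ → ∃ t, 0 ≤ t ∧ γ t ∈ S}

/-- The Cauchy development `D(S) = D⁺(S) ∪ D⁻(S)`. -/
def cauchyDevelopment (T : TimeOrientation g) (S : Set M) : Set M :=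
  futureCauchyDevelopment T S ∪ pastCauchyDevelopment T S

/-- `S` is achronal: no two points of `S` (equal or not) are joined by a timelike curve. -/
def IsAchronal (T : TimeOrientation g) (S : Set M) : Prop :=
  ∀ x ∈ S, ∀ y ∈ S, ¬ ChronologicallyPrecedes T x y

/-- A Cauchy surface: a closed achronal set whose Cauchy development is the whole space-time.
A space-time is globally hyperbolic if and only if it has one. -/
structure IsCauchySurface (T : TimeOrientation g) (S : Set M) : Prop where
  isClosed : IsClosed S
  achronal : IsAchronal T S
  cauchyDevelopment_eq : cauchyDevelopment T S = univ

variable (n) in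
/-- `S` is a smooth (embedded) hypersurface: around each of its points there is a smooth chart
of `M` in which `S` is the coordinate hyperplane on which the first coordinate vanishes. -/
def IsSmoothHypersurface (S : Set M) : Prop :=
  ∀ x ∈ S, ∃ e ∈ IsManifold.maximalAtlas (𝓡 (n + 1)) ∞ M, x ∈ e.source ∧
    ∀ y ∈ e.source, y ∈ S ↔ e y 0 = 0

end Causality

end LorentzGeometry

/-! If the conclusion fails, then for infinitely many `i` there are points `s i ≤ x i ≤ u i` with `s
i ∈ S` and `x i ∉ U`. The key fact is `IsCauchySurface.exists_tendsto_causallyPrecedes`: along an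
ultrafilter, causal predecessors in J⁺(S) of convergent points converge, and the causal relation
passes to the limit. Applied to `x i ≤ u i` and then to `s i ≤ x i`, it gives `z ≤ y ≤ q` with `z ∈
S` and `y ∉ U`, because `S` and the complement of `U` are closed. This contradicts the inclusion at
`q`.

For the key fact, suppose `a i ≤ b i → y` with `a i` in J⁺(S), but `a` has no limit below `y`. Let
`Q` consist of the points below `y` that are limits of points above the `a i`, and let `W` be the
union of the chronological futures of points of `Q`. Openness of chronological pasts and the push-up
property give W ⊆ I⁺(S), so `W` misses `S` by achronality. Near a point of `Q`, the causal curves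
coming from `a i` cannot start inside a small coordinate ball for almost all `i`, since `a` would
then converge. Hence they enter through the boundary, and the entry points converge to another point
of `Q`. So a past directed causal curve in `W` can leave every small ball, and these pieces combine
into a past inextendible curve missing `S`. A future inextendible curve missing `S` is easier to
find, and the two contradict D(S) = M.

The local limits use cone fields. In a small chart the light cones form a Lipschitz field of closed
convex, uniformly sharp cones. Causality of a curve then amounts to a condition on its chords
(`IsConeCurve`), which survives pointwise limits and gives back causal velocities by
differentiation. Pushing such a curve along a timelike axis by an exponentially growing amount makes
its short chords timelike (`IsConeCurve.chord_mem`), whence the push-up property. -/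

namespace LorentzGeometry

/-! ### Lipschitz cone fields and limits of their curves -/

section ConeField

variable {E : Type*} [NormedAddCommGroup E] [NormedSpace ℝ E]

/-- A Lipschitz curve whose velocity lies almost everywhere in a closed convex cone has its total
displacement in that cone. -/
theorem sub_mem_of_ae_hasDerivAt_mem {D : Set E} (hD : IsClosed D) (h0 : (0 : E) ∈ D)
    (hadd : ∀ v ∈ D, ∀ w ∈ D, v + w ∈ D) (hsmul : ∀ c : ℝ, 0 ≤ c → ∀ v ∈ D, c • v ∈ D)
    {σ : ℝ → E} {α β : ℝ} (hαβ : α ≤ β) (hσ : LocallyLipschitzOn (Icc α β) σ)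
    (hder : ∀ᵐ t, t ∈ Icc α β → ∃ v ∈ D, HasDerivAt σ v t) : σ β - σ α ∈ D := by
  let P : ProperCone ℝ E :=
    { carrier := D
      add_mem' := fun {v w} hv hw ↦ hadd v hv w hw
      zero_mem' := h0
      smul_mem' := fun c v hv ↦ hsmul c c.2 v hv
      isClosed' := hD }
  by_contra hnot
  -- A functional nonnegative on the cone and negative at the displacement is impossible: along `σ`
  -- it is absolutely continuous with nonnegative derivative.
  obtain ⟨ℓ, hℓ, hneg⟩ := P.hyperplane_separation_point (x₀ := σ β - σ α) hnot
  obtain ⟨L, hL⟩ := hσ.exists_lipschitzOnWith_of_compact isCompact_Icc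
  have hLip : LipschitzOnWith (‖ℓ‖₊ * L) (fun t ↦ ℓ (σ t)) (uIcc α β) := by
    rw [uIcc_of_le hαβ]
    exact ℓ.lipschitz.comp_lipschitzOnWith hL
  have hint := hLip.absolutelyContinuousOnInterval.integral_deriv_eq_sub
  have hnn : 0 ≤ ∫ t in α..β, deriv (fun t ↦ ℓ (σ t)) t := by
    apply intervalIntegral.integral_nonneg_of_ae_restrict hαβ
    rw [Filter.EventuallyLE, ae_restrict_iff' measurableSet_Icc]
    filter_upwards [hder] with t ht htm
    obtain ⟨v, hv, hd⟩ := ht htm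
    have : HasDerivAt (fun t ↦ ℓ (σ t)) (ℓ v) t := ℓ.hasFDerivAt.comp_hasDerivAt t hd
    rw [this.deriv]
    exact hℓ v hv
  rw [hint] at hnn
  rw [map_sub] at hneg
  linarith

/-- A field of closed convex cones, Lipschitz on `B` in the sense of `lip`, which are uniformly
sharp with respect to the functional `f`. -/
structure IsLipschitzConeField (B : Set E) (C : E → Set E) (f : E →L[ℝ] ℝ) (e : E) (K : ℝ) :
    Prop where
  isClosed : ∀ z ∈ B, IsClosed (C z)
  add_mem : ∀ z ∈ B, ∀ v ∈ C z, ∀ w ∈ C z, v + w ∈ C z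
  smul_mem : ∀ z ∈ B, ∀ c : ℝ, 0 ≤ c → ∀ v ∈ C z, c • v ∈ C z
  norm_le : ∀ z ∈ B, ∀ v ∈ C z, ‖v‖ ≤ f v
  axis_mem : ∀ z ∈ B, e ∈ C z
  norm_axis : ‖e‖ = 1
  nonneg : 0 ≤ K
  -- Changing the base point is paid for by a shift along the axis, proportional to the distance and
  -- to the size of `v` as measured by `f`.
  lip : ∀ z ∈ B, ∀ z' ∈ B, ∀ v ∈ C z, v + (K * ‖z' - z‖ * f v) • e ∈ C z'

/-- A curve in `X` from `a` to `b` that is causal for the cone field `C` in an integrated sense,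
parametrized by the values of `f`. -/
structure IsConeCurve (B : Set E) (C : E → Set E) (f : E →L[ℝ] ℝ) (e : E) (K : ℝ) (X : Set E)
    (a b : E) (σ : ℝ → E) : Prop where
  le : f a ≤ f b
  left : σ 0 = a
  right : σ (f b - f a) = b
  mem : ∀ s ∈ Icc 0 (f b - f a), σ s ∈ X
  param : ∀ s ∈ Icc 0 (f b - f a), f (σ s) = f a + s
  norm_sub_le : ∀ s s', 0 ≤ s → s ≤ s' → s' ≤ f b - f a → ‖σ s' - σ s‖ ≤ s' - s
  -- The correction covers the distance from `z` to `σ s` and the length of the arc. For `z = σ s`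
  -- it is quadratic in `s' - s`, so it disappears on differentiation. Unlike a condition on
  -- derivatives, this one is closed under pointwise limits.
  cone : ∀ s s', 0 ≤ s → s ≤ s' → s' ≤ f b - f a → ∀ z ∈ B,
    σ s' - σ s + (K * (‖z - σ s‖ + (s' - s)) * (s' - s)) • e ∈ C z

variable {B : Set E} {C : E → Set E} {f : E →L[ℝ] ℝ} {e : E} {K : ℝ} {X : Set E} {a b : E}

namespace IsLipschitzConeField

theorem zero_mem (hC : IsLipschitzConeField B C f e K) {z : E} (hz : z ∈ B) : (0 : E) ∈ C z := by
  simpa using hC.smul_mem z hz 0 le_rfl e (hC.axis_mem z hz)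

theorem add_smul_axis_mem (hC : IsLipschitzConeField B C f e K) {z v : E} (hz : z ∈ B)
    (hv : v ∈ C z) {c : ℝ} (hc : 0 ≤ c) : v + c • e ∈ C z :=
  hC.add_mem z hz v hv _ (hC.smul_mem z hz c hc e (hC.axis_mem z hz))

/-- A curve whose velocity lies almost everywhere in the cone field is, after reparametrization,
a cone curve. -/
theorem exists_isConeCurve (hC : IsLipschitzConeField B C f e K) (hXB : X ⊆ B) {γ : ℝ → E}
    {α β : ℝ} (hαβ : α ≤ β) (hγ : LocallyLipschitzOn (Icc α β) γ)
    (hX : ∀ t ∈ Icc α β, γ t ∈ X)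
    (hder : ∀ᵐ t, t ∈ Icc α β → ∃ v ∈ C (γ t), HasDerivAt γ v t) :
    ∃ σ, IsConeCurve B C f e K X (γ α) (γ β) σ := by
  -- The inequality ‖v‖ ≤ f v itself defines a closed convex cone. Consequently `f` is nondecreasing
  -- along `γ` and its value determines the point of the curve.
  have hsub : ∀ t t', α ≤ t → t ≤ t' → t' ≤ β → ‖γ t' - γ t‖ ≤ f (γ t') - f (γ t) := by
    intro t t' ht htt' ht'
    have hI : Icc t t' ⊆ Icc α β := Icc_subset_Icc ht ht'
    have := sub_mem_of_ae_hasDerivAt_mem (D := {v : E | ‖v‖ ≤ f v})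
      (isClosed_le continuous_norm f.continuous) (by simp)
      (fun v hv w hw ↦ by
        have := norm_add_le v w
        simp only [mem_ofPred_eq, map_add] at *
        linarith)
      (fun c hc v hv ↦ by
        simp only [mem_ofPred_eq, norm_smul, map_smul, smul_eq_mul, Real.norm_of_nonneg hc] at *
        gcongr) htt' (hγ.mono hI) (by
          filter_upwards [hder] with τ hτ hm
          obtain ⟨v, hv, hd⟩ := hτ (hI hm)
          exact ⟨v, hC.norm_le _ (hXB (hX τ (hI hm))) v hv, hd⟩)
    simpa using this
  have hcone : ∀ t t', α ≤ t → t ≤ t' → t' ≤ β → ∀ z ∈ B,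
      γ t' - γ t + (K * (‖z - γ t‖ + (f (γ t') - f (γ t))) * (f (γ t') - f (γ t))) • e ∈ C z := by
    intro t t' ht htt' ht' z hz
    have hI : Icc t t' ⊆ Icc α β := Icc_subset_Icc ht ht'
    -- The bracket bounds ‖z - γ τ‖ for every `τ` between `t` and `t'`, so the velocity of γ + (k
    -- f(γ)) e stays in the single cone `C z`.
    set k := K * (‖z - γ t‖ + (f (γ t') - f (γ t))) with hk
    have hlip : LocallyLipschitzOn (Icc t t') (fun τ ↦ γ τ + (k * f (γ τ)) • e) := by
      obtain ⟨L, hL⟩ := (hγ.mono hI).exists_lipschitzOnWith_of_compact isCompact_Icc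
      have h1 : LipschitzWith (1 + ‖(k • f).smulRight e‖₊)
          (fun x : E ↦ x + ((k • f).smulRight e) x) :=
        LipschitzWith.id.add ((k • f).smulRight e).lipschitz
      have := h1.comp_lipschitzOnWith hL
      exact fun x _ ↦ ⟨_, _, self_mem_nhdsWithin, this⟩
    have := sub_mem_of_ae_hasDerivAt_mem (hC.isClosed z hz) (hC.zero_mem hz) (hC.add_mem z hz)
      (hC.smul_mem z hz) htt' hlip (by
        filter_upwards [hder] with τ hτ hm
        obtain ⟨v, hv, hd⟩ := hτ (hI hm)
        refine ⟨v + (k * f v) • e, ?_, ?_⟩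
        · have hτB := hXB (hX τ (hI hm))
          have h1 := hC.lip _ hτB z hz v hv
          have hfv : 0 ≤ f v := (norm_nonneg v).trans (hC.norm_le _ hτB v hv)
          have hn : ‖z - γ τ‖ ≤ ‖z - γ t‖ + (f (γ t') - f (γ t)) := by
            have e1 := hsub t τ ht hm.1 (hm.2.trans ht')
            have e2 := hsub τ t' (ht.trans hm.1) hm.2 ht'
            have e3 : ‖z - γ τ‖ ≤ ‖z - γ t‖ + ‖γ τ - γ t‖ := by
              have := norm_sub_le (z - γ t) (γ τ - γ t)
              simpa using this
            have := norm_nonneg (γ t' - γ τ)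
            linarith
          have h2 := hC.add_smul_axis_mem hz h1 (c := k * f v - K * ‖z - γ τ‖ * f v) (by
            have := mul_le_mul_of_nonneg_left hn hC.nonneg
            have := mul_le_mul_of_nonneg_right this hfv
            linarith)
          rwa [add_assoc, ← add_smul, add_sub_cancel] at h2
        · have hfd : HasDerivAt (fun τ ↦ f (γ τ)) (f v) τ := f.hasFDerivAt.comp_hasDerivAt τ hd
          exact hd.add ((hfd.const_mul k).smul_const e))
    convert this using 1
    rw [mul_sub, sub_smul]
    abel
  have hmono : ∀ t t', α ≤ t → t ≤ t' → t' ≤ β → f (γ t) ≤ f (γ t') := fun t t' h1 h2 h3 ↦ by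
    have := hsub t t' h1 h2 h3
    have := norm_nonneg (γ t' - γ t)
    linarith
  have hle := hmono α β le_rfl hαβ le_rfl
  have hex : ∀ s ∈ Icc 0 (f (γ β) - f (γ α)), ∃ t ∈ Icc α β, f (γ t) = f (γ α) + s := by
    intro s hs
    have hc : ContinuousOn (fun t ↦ f (γ t)) (Icc α β) :=
      f.continuous.comp_continuousOn hγ.continuousOn
    exact intermediate_value_Icc hαβ hc ⟨by linarith [hs.1], by linarith [hs.2]⟩
  -- No continuity of `τ` is needed: `γ ∘ τ` does not depend on the choice and is 1-Lipschitz by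
  -- `hsub`.
  choose! τ hτ hfτ using hex
  have hτle : ∀ s s', 0 ≤ s → s < s' → s' ≤ f (γ β) - f (γ α) → τ s ≤ τ s' := by
    intro s s' h0 hlt h1
    by_contra! hcon
    have := hmono (τ s') (τ s) (hτ s' ⟨by linarith, h1⟩).1 hcon.le (hτ s ⟨h0, by linarith⟩).2
    rw [hfτ s' ⟨by linarith, h1⟩, hfτ s ⟨h0, by linarith⟩] at this
    linarith
  have hsame : ∀ t ∈ Icc α β, ∀ t' ∈ Icc α β, f (γ t) = f (γ t') → γ t = γ t' := by
    intro t ht t' ht' h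
    rcases le_total t t' with hle | hle
    · have := hsub t t' ht.1 hle ht'.2
      rw [h, sub_self] at this
      exact (sub_eq_zero.1 (norm_le_zero_iff.1 this)).symm
    · have := hsub t' t ht'.1 hle ht.2
      rw [h, sub_self] at this
      exact sub_eq_zero.1 (norm_le_zero_iff.1 this)
  refine ⟨fun s ↦ γ (τ s), hle, ?_, ?_, ?_, ?_, ?_, ?_⟩
  · have h0 : (0 : ℝ) ∈ Icc 0 (f (γ β) - f (γ α)) := ⟨le_rfl, by linarith⟩
    exact hsame _ (hτ 0 h0) _ ⟨le_rfl, hαβ⟩ (by rw [hfτ 0 h0, add_zero])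
  · have h0 : f (γ β) - f (γ α) ∈ Icc 0 (f (γ β) - f (γ α)) := ⟨by linarith, le_rfl⟩
    exact hsame _ (hτ _ h0) _ ⟨hαβ, le_rfl⟩ (by rw [hfτ _ h0]; ring)
  · exact fun s hs ↦ hX _ (hτ s hs)
  · exact hfτ
  · intro s s' h0 hss h1
    rcases hss.eq_or_lt with rfl | hlt
    · simp
    have hs : s ∈ Icc 0 (f (γ β) - f (γ α)) := ⟨h0, hss.trans h1⟩
    have hs' : s' ∈ Icc 0 (f (γ β) - f (γ α)) := ⟨h0.trans hss, h1⟩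
    have := hsub _ _ (hτ s hs).1 (hτle s s' h0 hlt h1) (hτ s' hs').2
    rwa [hfτ s hs, hfτ s' hs', add_sub_add_left_eq_sub] at this
  · intro s s' h0 hss h1 z hz
    rcases hss.eq_or_lt with rfl | hlt
    · simpa using hC.zero_mem hz
    have hs : s ∈ Icc 0 (f (γ β) - f (γ α)) := ⟨h0, hss.trans h1⟩
    have hs' : s' ∈ Icc 0 (f (γ β) - f (γ α)) := ⟨h0.trans hss, h1⟩
    have := hcone _ _ (hτ s hs).1 (hτle s s' h0 hlt h1) (hτ s' hs').2 z hz
    rwa [hfτ s hs, hfτ s' hs', add_sub_add_left_eq_sub] at this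

end IsLipschitzConeField

namespace IsConeCurve

/-- Cone curves in a compact set are stable under limits. -/
theorem exists_of_tendsto (hC : IsLipschitzConeField B C f e K) (hX : IsCompact X)
    {ι : Type*} {𝒰 : Ultrafilter ι} {u v : ι → E} {σ : ι → ℝ → E}
    (hσ : ∀ᶠ i in 𝒰, IsConeCurve B C f e K X (u i) (v i) (σ i))
    (hu : Tendsto u 𝒰 (𝓝 a)) (hv : Tendsto v 𝒰 (𝓝 b)) :
    ∃ σ, IsConeCurve B C f e K X a b σ := by
  have hfu : Tendsto (fun i ↦ f (u i)) 𝒰 (𝓝 (f a)) := (f.continuous.tendsto a).comp hu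
  have hfv : Tendsto (fun i ↦ f (v i)) 𝒰 (𝓝 (f b)) := (f.continuous.tendsto b).comp hv
  have hlen : Tendsto (fun i ↦ f (v i) - f (u i)) 𝒰 (𝓝 (f b - f a)) := hfv.sub hfu
  have hle : f a ≤ f b := le_of_tendsto_of_tendsto hfu hfv (hσ.mono fun i h ↦ h.le)
  set ℓ := f b - f a with hℓ
  have hℓ0 : 0 ≤ ℓ := sub_nonneg.2 hle
  -- The parameter intervals vary with `i`; truncation keeps each parameter admissible and is
  -- harmless in the limit.
  let clamp : ι → ℝ → ℝ := fun i s ↦ min s (f (v i) - f (u i))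
  have hclamp : ∀ s ∈ Icc 0 ℓ, Tendsto (fun i ↦ clamp i s) 𝒰 (𝓝 s) := by
    intro s hs
    have : Tendsto (fun i ↦ clamp i s) 𝒰 (𝓝 (min s ℓ)) := tendsto_const_nhds.min hlen
    rwa [min_eq_left hs.2] at this
  have hclamp_mem : ∀ᶠ i in 𝒰, ∀ s, 0 ≤ s → clamp i s ∈ Icc 0 (f (v i) - f (u i)) := by
    filter_upwards [hσ] with i hi s hs
    exact ⟨le_min hs (sub_nonneg.2 hi.le), min_le_right _ _⟩
  -- Ultrafilter limits taken separately at each parameter suffice, since every clause of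
  -- `IsConeCurve` is a closed condition on at most two values of the curve.
  have hex : ∀ s, 0 ≤ s → ∃ x ∈ X, Tendsto (fun i ↦ σ i (clamp i s)) 𝒰 (𝓝 x) := by
    intro s hs
    have hm : ∀ᶠ i in 𝒰, σ i (clamp i s) ∈ X := by
      filter_upwards [hσ, hclamp_mem] with i hi hc
      exact hi.mem _ (hc s hs)
    exact hX.ultrafilter_le_nhds (𝒰.map fun i ↦ σ i (clamp i s)) (le_principal_iff.2 hm)
  choose! ρ hρX hρ using hex
  have hmono : ∀ i s s', s ≤ s' → clamp i s ≤ clamp i s' := fun i s s' h ↦ min_le_min_right _ h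
  have hnorm : ∀ s s', 0 ≤ s → s ≤ s' → s' ≤ ℓ → ‖ρ s' - ρ s‖ ≤ s' - s := by
    intro s s' h0 hss h1
    refine le_of_tendsto_of_tendsto ((hρ s' (h0.trans hss)).sub (hρ s h0)).norm
      ((hclamp s' ⟨h0.trans hss, h1⟩).sub (hclamp s ⟨h0, hss.trans h1⟩)) ?_
    filter_upwards [hσ, hclamp_mem] with i hi hc
    exact hi.norm_sub_le _ _ (hc s h0).1 (hmono i s s' hss) (hc s' (h0.trans hss)).2
  refine ⟨ρ, hle, ?_, ?_, fun s hs ↦ hρX s hs.1, ?_, hnorm, ?_⟩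
  · refine tendsto_nhds_unique (hρ 0 le_rfl) (hu.congr' ?_)
    filter_upwards [hσ] with i hi
    have : clamp i 0 = 0 := min_eq_left (sub_nonneg.2 hi.le)
    rw [this, hi.left]
  · have h1 : Tendsto (fun i ↦ v i - σ i (clamp i ℓ)) 𝒰 (𝓝 0) := by
      have hz : Tendsto (fun i ↦ (f (v i) - f (u i)) - clamp i ℓ) 𝒰 (𝓝 0) := by
        simpa using hlen.sub (hclamp ℓ ⟨hℓ0, le_rfl⟩)
      refine squeeze_zero_norm' ?_ hz
      filter_upwards [hσ, hclamp_mem] with i hi hc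
      have := hi.norm_sub_le _ _ (hc ℓ hℓ0).1 (hc ℓ hℓ0).2 le_rfl
      rwa [hi.right] at this
    have h2 := hv.sub h1
    simp only [sub_sub_cancel, sub_zero] at h2
    exact tendsto_nhds_unique (hρ ℓ hℓ0) h2
  · intro s hs
    refine tendsto_nhds_unique ((f.continuous.tendsto _).comp (hρ s hs.1))
      ((hfu.add (hclamp s hs)).congr' ?_)
    filter_upwards [hσ, hclamp_mem] with i hi hc
    exact (hi.param _ (hc s hs.1)).symm
  · intro s s' h0 hss h1 z hz
    have c1 := hclamp s ⟨h0, hss.trans h1⟩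
    have c2 := hclamp s' ⟨h0.trans hss, h1⟩
    have r1 := hρ s h0
    have r2 := hρ s' (h0.trans hss)
    refine (hC.isClosed z hz).mem_of_tendsto ((r2.sub r1).add
      ((((tendsto_const_nhds (x := K)).mul (((tendsto_const_nhds (x := z)).sub r1).norm.add
        (c2.sub c1))).mul (c2.sub c1)).smul (tendsto_const_nhds (x := e)))) ?_
    filter_upwards [hσ, hclamp_mem] with i hi hc
    exact hi.cone _ _ (hc s h0).1 (hmono i s s' hss) (hc s' (h0.trans hss)).2 z hz

theorem lipschitzOnWith {σ : ℝ → E} (hσ : IsConeCurve B C f e K X a b σ) :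
    LipschitzOnWith 1 σ (Icc 0 (f b - f a)) := by
  refine LipschitzOnWith.of_dist_le_mul fun s hs s' hs' ↦ ?_
  rw [NNReal.coe_one, one_mul]
  rcases le_total s s' with h | h
  · rw [dist_comm, dist_eq_norm, dist_comm, Real.dist_eq, abs_of_nonneg (sub_nonneg.2 h)]
    exact hσ.norm_sub_le s s' hs.1 h hs'.2
  · rw [dist_eq_norm, Real.dist_eq, abs_of_nonneg (sub_nonneg.2 h)]
    exact hσ.norm_sub_le s' s hs'.1 h hs.2

/-- The velocity of a cone curve lies in the cone and is normalized by `f`. -/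
theorem mem_of_hasDerivAt (hC : IsLipschitzConeField B C f e K) (hXB : X ⊆ B) {σ : ℝ → E}
    (hσ : IsConeCurve B C f e K X a b σ) {t : ℝ} (ht : t ∈ Ioo 0 (f b - f a)) {v : E}
    (hv : HasDerivAt σ v t) : v ∈ C (σ t) ∧ f v = 1 := by
  have hB : σ t ∈ B := hXB (hσ.mem t ⟨ht.1.le, ht.2.le⟩)
  have hslope : Tendsto (fun h : ℝ ↦ h⁻¹ • (σ (t + h) - σ t)) (𝓝[>] 0) (𝓝 v) :=
    (hasDerivAt_iff_tendsto_slope_zero.1 hv).mono_left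
      (nhdsWithin_mono _ fun x hx ↦ ne_of_gt hx)
  have hsmall : ∀ᶠ h : ℝ in 𝓝[>] 0, 0 < h ∧ t + h < f b - f a := by
    filter_upwards [self_mem_nhdsWithin,
      nhdsWithin_le_nhds (Iio_mem_nhds (sub_pos.2 ht.2))] with h h1 h2
    exact ⟨h1, by simp only [mem_Iio] at h2; linarith⟩
  constructor
  -- With `z = σ t` the correction over a step `h` is K h² e, which becomes K h e after division by
  -- `h`.
  · have hlim : Tendsto (fun h : ℝ ↦ h⁻¹ • (σ (t + h) - σ t) + (K * h) • e) (𝓝[>] 0)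
        (𝓝 (v + (K * 0) • e)) := by
      refine hslope.add (Tendsto.smul_const ?_ e)
      exact (tendsto_id.const_mul K).mono_left nhdsWithin_le_nhds
    rw [mul_zero, zero_smul, add_zero] at hlim
    refine (hC.isClosed _ hB).mem_of_tendsto hlim ?_
    filter_upwards [hsmall] with h ⟨h0, h1⟩
    have := hC.smul_mem _ hB h⁻¹ (inv_nonneg.2 h0.le) _
      (hσ.cone t (t + h) ht.1.le (by linarith) h1.le _ hB)
    rw [smul_add, smul_smul] at this
    convert this using 3
    simp only [sub_self, norm_zero, zero_add, add_sub_cancel_left]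
    field_simp
  · refine tendsto_nhds_unique ((f.continuous.tendsto v).comp hslope) ?_
    refine tendsto_const_nhds.congr' ?_
    filter_upwards [hsmall] with h ⟨h0, h1⟩
    simp only [Function.comp_apply, map_smul, map_sub, smul_eq_mul]
    rw [hσ.param t ⟨ht.1.le, ht.2.le⟩, hσ.param (t + h) ⟨by linarith [ht.1], h1.le⟩]
    field_simp
    ring

/-- A cone curve can be pushed along the axis so that all its short chords are strictly inside
the cones. -/
theorem chord_mem (hC : IsLipschitzConeField B C f e K) {σ : ℝ → E}
    (hσ : IsConeCurve B C f e K X a b σ) {δ : ℝ} (hδ : 0 < δ) {s s' : ℝ} (h0 : 0 ≤ s)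
    (hss : s < s') (h1 : s' ≤ f b - f a) (hs1 : 2 * (s' - s) ≤ δ) (hs2 : 2 * K * (s' - s) ≤ 1)
    {z : E} (hzB : z ∈ B)
    (hz : z ∈ segment ℝ (σ s + (δ * (Real.exp ((2 * K + 1) * s) - 1)) • e)
      (σ s' + (δ * (Real.exp ((2 * K + 1) * s') - 1)) • e)) :
    ∃ h : ℝ, 0 < h ∧ (σ s' + (δ * (Real.exp ((2 * K + 1) * s') - 1)) • e) -
      (σ s + (δ * (Real.exp ((2 * K + 1) * s) - 1)) • e) - h • e ∈ C z := by
  set Δ := s' - s with hΔ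
  have hΔ0 : 0 < Δ := sub_pos.2 hss
  have hK := hC.nonneg
  -- A Grönwall-type choice: the offset grows at rate (2K + 1)(offset + δ), while the cone
  -- correction costs roughly K (offset + δ) per unit of parameter.
  set H := δ * (Real.exp ((2 * K + 1) * s) - 1) with hH
  set H' := δ * (Real.exp ((2 * K + 1) * s') - 1) with hH'
  have hH0 : 0 ≤ H := by
    have : 1 ≤ Real.exp ((2 * K + 1) * s) := Real.one_le_exp (by positivity)
    exact mul_nonneg hδ.le (by linarith)
  have hinc : (2 * K + 1) * Δ * (H + δ) ≤ H' - H := by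
    have e1 : Real.exp ((2 * K + 1) * s') =
        Real.exp ((2 * K + 1) * s) * Real.exp ((2 * K + 1) * Δ) := by
      rw [← Real.exp_add, hΔ]; ring_nf
    have e2 := Real.add_one_le_exp ((2 * K + 1) * Δ)
    have e3 := mul_le_mul_of_nonneg_left e2
      (mul_nonneg hδ.le (Real.exp_pos ((2 * K + 1) * s)).le)
    rw [hH', hH, e1]
    linarith
  have hinc0 : 0 ≤ H' - H := le_trans (by positivity) hinc
  have hd : ‖z - σ s‖ ≤ H' + Δ := by
    obtain ⟨θ, η, hθ, hη, hθη, rfl⟩ := hz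
    have e1 : θ • (σ s + H • e) + η • (σ s' + H' • e) - σ s =
        η • (σ s' - σ s) + (θ * H + η * H') • e := by
      have : θ = 1 - η := by linarith
      subst this
      module
    rw [e1]
    refine (norm_add_le _ _).trans ?_
    rw [norm_smul, norm_smul, hC.norm_axis, mul_one, Real.norm_of_nonneg hη,
      Real.norm_of_nonneg (by nlinarith)]
    have e2 := hσ.norm_sub_le s s' h0 hss.le h1
    have hη1 : η ≤ 1 := by linarith
    have e3 := mul_le_mul_of_nonneg_right hη1 (norm_nonneg (σ s' - σ s))
    have e4 : θ * H + η * H' ≤ H' := by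
      have : θ = 1 - η := by linarith
      subst this
      nlinarith
    linarith
  have hcone := hσ.cone s s' h0 hss.le h1 z hzB
  rw [← hΔ] at hcone
  refine ⟨H' - H - K * (‖z - σ s‖ + Δ) * Δ, ?_, ?_⟩
  -- Half of `H' - H` pays for the change of offset over the step (2KΔ ≤ 1). The other half exceeds
  -- KΔ(H + δ) because of the extra 1 in the exponent.
  · have b1 : K * (‖z - σ s‖ + Δ) * Δ ≤ K * (H' + Δ + Δ) * Δ := by gcongr
    have b2 : K * Δ * (H' - H) ≤ (H' - H) / 2 := by nlinarith
    have b3 : K * Δ * (H + 2 * Δ) ≤ K * Δ * (H + δ) := by gcongr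
    have b4 : 0 < Δ * (H + δ) := by positivity
    have b5 : K * (H' + Δ + Δ) * Δ = K * Δ * (H' - H) + K * Δ * (H + 2 * Δ) := by ring
    nlinarith
  · convert hcone using 1
    module

end IsConeCurve

end ConeField

/-! ### Causal cones of Lorentzian forms -/

section ConeOfForm

/-- For a symmetric form of Lorentzian signature, no causal vector is orthogonal to a timelike
one. -/
theorem ne_zero_of_timelike_of_causal {V : Type*} [AddCommGroup V] [Module ℝ V]
    [TopologicalSpace V] (G : V →L[ℝ] V →L[ℝ] ℝ) (hsymm : ∀ v w, G v w = G w v)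
    (hsig : ∃ v, G v v < 0 ∧ ∀ w, G v w = 0 → w ≠ 0 → 0 < G w w) {t v : V} (ht : G t t < 0)
    (hv0 : v ≠ 0) (hv : G v v ≤ 0) : G t v ≠ 0 := by
  intro htv
  obtain ⟨w, hw, hpos⟩ := hsig
  have ht0 : t ≠ 0 := by rintro rfl; simp at ht
  have hβ : G w t ≠ 0 := fun h ↦ absurd (hpos t h ht0) (not_lt.2 ht.le)
  -- The vector α t - β v is orthogonal to `w` but not spacelike, so it vanishes. Pairing it with
  -- `t` gives α = 0, and then β ≠ 0 contradicts v ≠ 0.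
  set α := G w v
  set β := G w t
  have h1 : G w (α • t - β • v) = 0 := by
    simp only [map_sub, map_smul, smul_eq_mul]
    ring
  have h2 : G (α • t - β • v) (α • t - β • v) = α ^ 2 * G t t + β ^ 2 * G v v := by
    simp only [map_sub, map_smul, smul_eq_mul, sub_apply, smul_apply,
      hsymm v t, htv]
    ring
  by_cases hu : α • t - β • v = 0
  · have h3 : G t (α • t - β • v) = α * G t t := by
      simp only [map_sub, map_smul, smul_eq_mul, htv]
      ring
    rw [hu, map_zero] at h3
    have hα : α = 0 := by
      rcases mul_eq_zero.1 h3.symm with h | h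
      · exact h
      · exact absurd h ht.ne
    rw [hα, zero_smul, zero_sub, neg_eq_zero, smul_eq_zero] at hu
    exact hu.elim hβ hv0
  · have := hpos _ h1 hu
    rw [h2] at this
    nlinarith [sq_nonneg α, sq_nonneg β]

variable {E : Type*} [NormedAddCommGroup E] [NormedSpace ℝ E]

/-- The cone of future causal vectors of the form `G`, where `f` selects the future half. -/
def formCone (G : E →L[ℝ] E →L[ℝ] ℝ) (f : E →L[ℝ] ℝ) : Set E := {v | G v v ≤ 0 ∧ 0 ≤ f v}

variable {G : E →L[ℝ] E →L[ℝ] ℝ} {f : E →L[ℝ] ℝ}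

/-- A substitute for the reverse Cauchy–Schwarz inequality: `f w • v - f v • w` lies in the kernel
of `f`, where `hle` excludes timelike vectors. Expanding the square gives the bound. -/
theorem mul_mul_le_of_causal (hsymm : ∀ v w, G v w = G w v)
    (hle : ∀ v, G v v ≤ 0 → ‖v‖ ≤ |f v|) (v w : E) :
    2 * (f v * f w * G v w) ≤ f w ^ 2 * G v v + f v ^ 2 * G w w := by
  have hu : 0 ≤ G (f w • v - f v • w) (f w • v - f v • w) := by
    by_contra! hcon
    have h1 := hle _ hcon.le
    have h2 : f (f w • v - f v • w) = 0 := by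
      simp only [map_sub, map_smul, smul_eq_mul]
      ring
    rw [h2, abs_zero, norm_le_zero_iff] at h1
    rw [h1] at hcon
    simp at hcon
  have h3 : G (f w • v - f v • w) (f w • v - f v • w) =
      f w ^ 2 * G v v + f v ^ 2 * G w w - 2 * (f v * f w * G v w) := by
    simp only [map_sub, map_smul, smul_eq_mul, sub_apply, smul_apply, hsymm w v]
    ring
  linarith

/-- This sign makes the half cone convex, and makes a causal vector timelike once a multiple of the
axis is added. -/
theorem formCone_apply_nonpos (hsymm : ∀ v w, G v w = G w v)
    (hle : ∀ v, G v v ≤ 0 → ‖v‖ ≤ |f v|) {v w : E} (hv : v ∈ formCone G f)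
    (hw : w ∈ formCone G f) : G v w ≤ 0 := by
  have h := mul_mul_le_of_causal hsymm hle v w
  rcases hv.2.eq_or_lt with h0 | h0
  · have := hle v hv.1
    rw [← h0, abs_zero, norm_le_zero_iff] at this
    simp [this]
  rcases hw.2.eq_or_lt with h1 | h1
  · have := hle w hw.1
    rw [← h1, abs_zero, norm_le_zero_iff] at this
    simp [this]
  by_contra! hcon
  have : 0 < f v * f w * G v w := by positivity
  have := mul_nonneg (sq_nonneg (f w)) (neg_nonneg.2 hv.1)
  have := mul_nonneg (sq_nonneg (f v)) (neg_nonneg.2 hw.1)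
  linarith

/-- A timelike vector in the future half detects the future causal vectors. -/
theorem causal_apply_neg_iff (hsymm : ∀ v w, G v w = G w v)
    (hle : ∀ v, G v v ≤ 0 → ‖v‖ ≤ |f v|) {t v : E} (ht : G t t < 0) (hft : 0 < f t)
    (hv0 : v ≠ 0) (hv : G v v ≤ 0) : G t v < 0 ↔ 0 < f v := by
  have h := mul_mul_le_of_causal hsymm hle t v
  have hf : f v ≠ 0 := by
    intro h0
    have := hle v hv
    rw [h0, abs_zero, norm_le_zero_iff] at this
    exact hv0 this
  have h1 : 0 < f v ^ 2 := by positivity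
  have h2 : f t * (f v * G t v) < 0 := by
    have e1 := mul_pos h1 (neg_pos.2 ht)
    have e2 := mul_nonneg (sq_nonneg (f t)) (neg_nonneg.2 hv)
    linarith
  have h3 : f v * G t v < 0 := by
    by_contra! hcon
    have := mul_nonneg hft.le hcon
    linarith
  constructor
  · intro hneg
    by_contra! hcon
    have := mul_nonneg (neg_nonneg.2 hcon) (neg_nonneg.2 hneg.le)
    linarith
  · intro hpos
    by_contra! hcon
    have := mul_nonneg hpos.le hcon
    linarith

variable [FiniteDimensional ℝ E]

/-- Around a point where `G` is Lipschitz and Lorentzian, the future causal vectors form a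
Lipschitz cone field. -/
theorem exists_isLipschitzConeField {G : E → E →L[ℝ] E →L[ℝ] ℝ} {τ : E → E} {z₀ : E} {U : Set E}
    (hU : U ∈ 𝓝 z₀) (hsymm : ∀ z ∈ U, ∀ v w, G z v w = G z w v)
    (hlip : ∃ L, ∃ s ∈ 𝓝 z₀, LipschitzOnWith L G s) (hτ : ContinuousAt τ z₀)
    (ht : G z₀ (τ z₀) (τ z₀) < 0) (hne : ∀ v ≠ 0, G z₀ v v ≤ 0 → G z₀ (τ z₀) v ≠ 0) :
    ∃ R > 0, ∃ (K : ℝ) (f : E →L[ℝ] ℝ) (e : E), Metric.ball z₀ R ⊆ U ∧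
      ContinuousOn G (Metric.ball z₀ R) ∧
      IsLipschitzConeField (Metric.ball z₀ R) (fun z ↦ formCone (G z) f) f e K ∧
      ∀ z ∈ Metric.ball z₀ R, (∀ v, G z v v ≤ 0 → ‖v‖ ≤ |f v|) ∧ G z e e < 0 ∧ 0 < f e ∧
        0 < f (τ z) := by
  obtain ⟨L, s, hs, hL⟩ := hlip
  have hGc : ContinuousAt G z₀ := (hL.continuousOn.continuousAt hs)
  set t := τ z₀
  have ht0 : t ≠ 0 := by rintro h; rw [h] at ht; simp at ht
  have htn : 0 < ‖t‖ := norm_pos_iff.2 ht0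
  have hcomp : IsCompact (Metric.sphere (0 : E) 1 ∩ {v | G z₀ v v ≤ 0}) :=
    (isCompact_sphere 0 1).inter_right (isClosed_le (by fun_prop) continuous_const)
  -- A positive bound from compactness of the unit causal vectors at `z₀`. The functional `f` is
  -- scaled so that |f v| ≥ 2 on them, leaving room to keep ‖v‖ ≤ |f v| nearby.
  obtain ⟨μ, hμ, hμle⟩ : ∃ μ > 0, ∀ v ∈ Metric.sphere (0 : E) 1 ∩ {v | G z₀ v v ≤ 0},
      μ ≤ |G z₀ t v| := by
    refine hcomp.exists_forall_le' (f := fun v ↦ |G z₀ t v|) (by fun_prop) fun v hv ↦ ?_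
    refine abs_pos.2 (hne v ?_ hv.2)
    rintro rfl
    simp at hv
  set f : E →L[ℝ] ℝ := (-(2 / μ)) • G z₀ t with hf
  have hfv : ∀ v, f v = -(2 / μ) * G z₀ t v := fun v ↦ rfl
  set e : E := ‖t‖⁻¹ • t with he
  have hee : G z₀ e e < 0 := by
    have : G z₀ e e = ‖t‖⁻¹ * (‖t‖⁻¹ * G z₀ t t) := by
      simp [he]
    rw [this]
    exact mul_neg_of_pos_of_neg (by positivity) (mul_neg_of_pos_of_neg (by positivity) ht)
  have hft : 0 < f t := by
    rw [hfv]
    have : 0 < 2 / μ := by positivity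
    nlinarith
  have hfe : 0 < f e := by
    rw [he, map_smul, smul_eq_mul]
    positivity
  -- A quarter of the lower bound μ/‖t‖ for |G z₀ v e| on unit causal vectors.
  set m := μ / 2 / ‖t‖ / 2 with hm
  have hm0 : 0 < m := by positivity
  -- Spacelike, future or past with a margin: each alternative is open in the pair (z, v), so
  -- compactness of the sphere makes the trichotomy uniform in `z`.
  have hev : ∀ᶠ z in 𝓝 z₀, ∀ v ∈ Metric.sphere (0 : E) 1, 0 < G z v v ∨
      (1 < f v ∧ G z v e < -m) ∨ (f v < -1 ∧ m < G z v e) := by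
    refine (isCompact_sphere (0 : E) 1).eventually_forall_of_forall_eventually fun v hv ↦ ?_
    have hc1 : ContinuousAt (fun q : E × E ↦ G q.1 q.2 q.2) (z₀, v) := by
      have : ContinuousAt (fun q : E × E ↦ G q.1) (z₀, v) :=
        ContinuousAt.comp (x := (z₀, v)) (g := G) (f := Prod.fst) hGc continuousAt_fst
      exact (this.clm_apply continuousAt_snd).clm_apply continuousAt_snd
    have hc2 : ContinuousAt (fun q : E × E ↦ G q.1 q.2 e) (z₀, v) := by
      have : ContinuousAt (fun q : E × E ↦ G q.1) (z₀, v) :=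
        ContinuousAt.comp (x := (z₀, v)) (g := G) (f := Prod.fst) hGc continuousAt_fst
      exact (this.clm_apply continuousAt_snd).clm_apply continuousAt_const
    have hc3 : ContinuousAt (fun q : E × E ↦ f q.2) (z₀, v) := by fun_prop
    by_cases hv1 : 0 < G z₀ v v
    · exact (continuousAt_const.eventually_lt hc1 hv1).mono fun q hq ↦ Or.inl hq
    · have h1 := hμle v ⟨hv, not_lt.1 hv1⟩
      have h2 : G z₀ v e = ‖t‖⁻¹ * G z₀ t v := by
        rw [hsymm z₀ (mem_of_mem_nhds hU) v e, he]
        simp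
      rcases lt_or_gt_of_ne (abs_pos.1 (hμ.trans_le h1)) with h3 | h3
      · rw [abs_of_neg h3] at h1
        have k1 : 1 < f v := by
          rw [hfv, neg_mul, ← mul_neg]
          calc (1 : ℝ) < 2 / μ * μ := by rw [div_mul_cancel₀ _ hμ.ne']; norm_num
            _ ≤ _ := by gcongr
        have k2 : G z₀ v e < -m := by
          have : m * ‖t‖ < μ := by
            rw [hm]; field_simp; linarith
          rw [h2, inv_mul_lt_iff₀ htn]
          linarith
        filter_upwards [continuousAt_const.eventually_lt hc3 k1,
          hc2.eventually_lt continuousAt_const k2] with q h4 h5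
        exact Or.inr (Or.inl ⟨h4, h5⟩)
      · rw [abs_of_pos h3] at h1
        have k1 : f v < -1 := by
          rw [hfv, neg_mul, neg_lt_neg_iff]
          calc (1 : ℝ) < 2 / μ * μ := by rw [div_mul_cancel₀ _ hμ.ne']; norm_num
            _ ≤ _ := by gcongr
        have k2 : m < G z₀ v e := by
          have : m * ‖t‖ < μ := by
            rw [hm]; field_simp; linarith
          rw [h2, lt_inv_mul_iff₀ htn]
          linarith
        filter_upwards [hc3.eventually_lt continuousAt_const k1,
          continuousAt_const.eventually_lt hc2 k2] with q h4 h5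
        exact Or.inr (Or.inr ⟨h4, h5⟩)
  have hev2 : ∀ᶠ z in 𝓝 z₀, G z e e < 0 := by
    have : ContinuousAt (fun z ↦ G z e e) z₀ :=
      (hGc.clm_apply continuousAt_const).clm_apply continuousAt_const
    exact this.eventually_lt continuousAt_const hee
  have hev3 : ∀ᶠ z in 𝓝 z₀, 0 < f (τ z) :=
    continuousAt_const.eventually_lt (f.continuous.continuousAt.comp hτ) hft
  obtain ⟨R₁, hR₁, hR₁s⟩ := Metric.eventually_nhds_iff_ball.1
    (hev.and (hev2.and (hev3.and (Filter.Eventually.and (p := (· ∈ U)) hU hs))))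
  -- The second bound ensures L‖z' - z‖ ≤ m/2 on the ball, so that moving from `z` to `z'` preserves
  -- half of the margin `m`.
  set R := min R₁ (m / (4 * (L + 1))) with hR
  have hR0 : 0 < R := by positivity
  have hball : ∀ z ∈ Metric.ball z₀ R, _ := fun z hz ↦
    hR₁s z (Metric.ball_subset_ball (min_le_left _ _) hz)
  have hscale : ∀ z ∈ Metric.ball z₀ R, ∀ v, G z v v ≤ 0 →
      ‖v‖ ≤ |f v| ∧ (0 ≤ f v → G z v e ≤ -m * ‖v‖) := by
    intro z hz v hv
    by_cases hv0 : v = 0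
    · simp [hv0]
    have hvn : 0 < ‖v‖ := norm_pos_iff.2 hv0
    have hmem : ‖v‖⁻¹ • v ∈ Metric.sphere (0 : E) 1 := by
      simp [norm_smul, hvn.ne']
    have h1 := (hball z hz).1 _ hmem
    simp only [map_smul, smul_eq_mul, smul_apply] at h1
    simp only [lt_inv_mul_iff₀ hvn, inv_mul_lt_iff₀ hvn, mul_zero] at h1
    rcases h1 with h1 | h1 | h1
    · linarith
    · exact ⟨by linarith [le_abs_self (f v), h1.1], fun _ ↦ by linarith [h1.2]⟩
    · refine ⟨by linarith [neg_le_abs (f v), h1.1], fun h ↦ ?_⟩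
      linarith [h1.1]
  have hle : ∀ z ∈ Metric.ball z₀ R, ∀ v, G z v v ≤ 0 → ‖v‖ ≤ |f v| :=
    fun z hz v hv ↦ (hscale z hz v hv).1
  have hsy : ∀ z ∈ Metric.ball z₀ R, ∀ v w, G z v w = G z w v :=
    fun z hz ↦ hsymm z (hball z hz).2.2.2.1
  have hBs : Metric.ball z₀ R ⊆ s := fun z hz ↦ (hball z hz).2.2.2.2
  have hfle : ∀ z ∈ Metric.ball z₀ R, ∀ v ∈ formCone (G z) f, ‖v‖ ≤ f v := fun z hz v hv ↦ by
    have := hle z hz v hv.1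
    rwa [abs_of_nonneg hv.2] at this
  -- Changing the base point raises G v v by at most L‖z' - z‖‖v‖². Adding `h • e` changes it by at
  -- most -h m‖v‖, and h = (L/m)‖z' - z‖ f v with f v ≥ ‖v‖ compensates.
  refine ⟨R, hR0, L / m, f, e, fun z hz ↦ (hball z hz).2.2.2.1, hL.continuousOn.mono hBs, ?_,
    fun z hz ↦ ⟨hle z hz, (hball z hz).2.1, hfe, (hball z hz).2.2.1⟩⟩
  refine ⟨?_, ?_, ?_, hfle, ?_, ?_, by positivity, ?_⟩
  · intro z hz
    exact (isClosed_le (f := fun v ↦ G z v v) (by fun_prop) continuous_const).inter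
      (isClosed_le continuous_const f.continuous)
  · intro z hz v hv w hw
    have h1 := formCone_apply_nonpos (hsy z hz) (hle z hz) hv hw
    refine ⟨?_, by rw [map_add]; exact add_nonneg hv.2 hw.2⟩
    have h2 := hv.1
    have h3 := hw.1
    simp only [map_add, add_apply, hsy z hz w v]
    linarith
  · intro z hz c hc v hv
    refine ⟨?_, by rw [map_smul]; exact mul_nonneg hc hv.2⟩
    simp only [map_smul, smul_apply, smul_eq_mul]
    have := mul_nonneg hc (mul_nonneg hc (neg_nonneg.2 hv.1))
    linarith
  · exact fun z hz ↦ ⟨(hball z hz).2.1.le, hfe.le⟩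
  · rw [he, norm_smul, norm_inv, norm_norm, inv_mul_cancel₀ htn.ne']
  · intro z hz z' hz' v hv
    have hfv0 := hfle z hz v hv
    have hvn := norm_nonneg v
    have hGd : ‖G z' - G z‖ ≤ L * ‖z' - z‖ := by
      have := hL.dist_le_mul z' (hBs hz') z (hBs hz)
      rwa [dist_eq_norm, dist_eq_norm] at this
    have hen : ‖e‖ = 1 := by rw [he, norm_smul, norm_inv, norm_norm, inv_mul_cancel₀ htn.ne']
    have hd1 : G z' v v ≤ L * ‖z' - z‖ * ‖v‖ * ‖v‖ := by
      have h1 : G z' v v = G z v v + (G z' - G z) v v := by simp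
      have h2 := (Real.le_norm_self _).trans ((G z' - G z).le_opNorm₂ v v)
      have h3 : ‖G z' - G z‖ * ‖v‖ * ‖v‖ ≤ L * ‖z' - z‖ * ‖v‖ * ‖v‖ := by gcongr
      linarith [hv.1]
    have hzz : L * ‖z' - z‖ ≤ m / 2 := by
      have h1 : ‖z' - z‖ ≤ R + R := by
        rw [← dist_eq_norm]
        have := dist_triangle_right z' z z₀
        have a1 := Metric.mem_ball.1 hz
        have a2 := Metric.mem_ball.1 hz'
        linarith
      have h2 : R ≤ m / (4 * (L + 1)) := min_le_right _ _
      rw [le_div_iff₀ (by positivity)] at h2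
      have h3 : (L : ℝ) * ‖z' - z‖ ≤ L * (R + R) := by gcongr
      nlinarith [L.2]
    have hd2 : G z' v e ≤ -(m / 2) * ‖v‖ := by
      have h1 : G z' v e = G z v e + (G z' - G z) v e := by simp
      have h2 := (Real.le_norm_self _).trans ((G z' - G z).le_opNorm₂ v e)
      have h3 : ‖G z' - G z‖ * ‖v‖ * ‖e‖ ≤ m / 2 * ‖v‖ := by
        rw [hen, mul_one]
        exact mul_le_mul_of_nonneg_right (hGd.trans hzz) hvn
      have h4 := (hscale z hz v hv.1).2 hv.2
      linarith
    set h := L / m * ‖z' - z‖ * f v with hh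
    have hh0 : 0 ≤ h := mul_nonneg (by positivity) hv.2
    refine ⟨?_, ?_⟩
    · have e1 : G z' (v + h • e) (v + h • e) =
          G z' v v + 2 * h * G z' v e + h * (h * G z' e e) := by
        simp only [map_add, map_smul, add_apply, smul_apply, smul_eq_mul, hsy z' hz' e v]
        ring
      have e2 : h * (h * G z' e e) ≤ 0 :=
        mul_nonpos_of_nonneg_of_nonpos hh0
          (mul_nonpos_of_nonneg_of_nonpos hh0 (hball z' hz').2.1.le)
      have e3 : 2 * h * G z' v e ≤ 2 * h * (-(m / 2) * ‖v‖) := by gcongr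
      have e4 : 2 * h * (-(m / 2) * ‖v‖) = -(L * ‖z' - z‖ * ‖v‖ * f v) := by
        rw [hh]; field_simp
      have e5 : L * ‖z' - z‖ * ‖v‖ * ‖v‖ ≤ L * ‖z' - z‖ * ‖v‖ * f v := by gcongr
      rw [e1]
      linarith
    · rw [map_add, map_smul]
      exact add_nonneg hv.2 (mul_nonneg hh0 hfe.le)

end ConeOfForm

/-! ### The metric and its curves in charts -/

section Chart

variable {n : ℕ} {M : Type*} [TopologicalSpace M]
  [ChartedSpace (EuclideanSpace ℝ (Fin (n + 1))) M] [IsManifold (𝓡 (n + 1)) ∞ M]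
  {g : LorentzianMetric n M}

/-- The derivative at `x` of the chart centred at `p`. -/
noncomputable def chartDeriv (p x : M) :
    TangentSpace (𝓡 (n + 1)) x →L[ℝ] EuclideanSpace ℝ (Fin (n + 1)) :=
  (trivializationAt (EuclideanSpace ℝ (Fin (n + 1)))
    (TangentSpace (𝓡 (n + 1)) : M → Type _) p).continuousLinearMapAt ℝ x

/-- The metric read in the chart centred at `p`. -/
noncomputable def chartForm (g : LorentzianMetric n M) (p : M) (z : EuclideanSpace ℝ (Fin (n + 1))) :
    EuclideanSpace ℝ (Fin (n + 1)) →L[ℝ] EuclideanSpace ℝ (Fin (n + 1)) →L[ℝ] ℝ :=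
  ContinuousLinearMap.inCoordinates (EuclideanSpace ℝ (Fin (n + 1)))
    (TangentSpace (𝓡 (n + 1)) : M → Type _)
    (EuclideanSpace ℝ (Fin (n + 1)) →L[ℝ] ℝ)
    (fun x : M ↦ TangentSpace (𝓡 (n + 1)) x →L[ℝ] ℝ) p
    ((extChartAt (𝓡 (n + 1)) p).symm z) p ((extChartAt (𝓡 (n + 1)) p).symm z)
    (g.val ((extChartAt (𝓡 (n + 1)) p).symm z))

theorem chartForm_chartDeriv {p x : M} (hx : x ∈ (extChartAt (𝓡 (n + 1)) p).source)
    (v w : TangentSpace (𝓡 (n + 1)) x) :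
    chartForm g p (extChartAt (𝓡 (n + 1)) p x) (chartDeriv p x v) (chartDeriv p x w) =
      g.val x v w := by
  have hb : x ∈ (trivializationAt (EuclideanSpace ℝ (Fin (n + 1)))
      (TangentSpace (𝓡 (n + 1)) : M → Type _) p).baseSet := by
    rw [extChartAt_source] at hx
    simpa using hx
  unfold chartForm
  rw [(extChartAt (𝓡 (n + 1)) p).left_inv hx,
    inCoordinates_apply_eq₂ hb hb (mem_univ _)]
  have h (u : TangentSpace (𝓡 (n + 1)) x) : (trivializationAt (EuclideanSpace ℝ (Fin (n + 1)))
      (TangentSpace (𝓡 (n + 1)) : M → Type _) p).symm x (chartDeriv p x u) = u := by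
    have := (trivializationAt (EuclideanSpace ℝ (Fin (n + 1)))
      (TangentSpace (𝓡 (n + 1)) : M → Type _) p).symmL_continuousLinearMapAt (R := ℝ) hb u
    rwa [Bundle.Trivialization.symmL_apply _ hb] at this
  rw [h, h]
  simp

theorem chartDeriv_surjective {p x : M} (hx : x ∈ (extChartAt (𝓡 (n + 1)) p).source) :
    Function.Surjective (chartDeriv (n := n) p x) := fun v ↦ by
  have hb : x ∈ (trivializationAt (EuclideanSpace ℝ (Fin (n + 1)))
      (TangentSpace (𝓡 (n + 1)) : M → Type _) p).baseSet := by
    rw [extChartAt_source] at hx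
    simpa using hx
  exact ⟨_, (trivializationAt (EuclideanSpace ℝ (Fin (n + 1)))
      (TangentSpace (𝓡 (n + 1)) : M → Type _) p).continuousLinearMapAt_symmL (R := ℝ) hb v⟩

theorem chartDeriv_eq_zero_iff {p x : M} (hx : x ∈ (extChartAt (𝓡 (n + 1)) p).source)
    {v : TangentSpace (𝓡 (n + 1)) x} : chartDeriv p x v = 0 ↔ v = 0 := by
  have hb : x ∈ (trivializationAt (EuclideanSpace ℝ (Fin (n + 1)))
      (TangentSpace (𝓡 (n + 1)) : M → Type _) p).baseSet := by
    rw [extChartAt_source] at hx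
    simpa using hx
  refine ⟨fun h ↦ ?_, fun h ↦ by rw [h, map_zero]⟩
  have := (trivializationAt (EuclideanSpace ℝ (Fin (n + 1)))
      (TangentSpace (𝓡 (n + 1)) : M → Type _) p).symmL_continuousLinearMapAt (R := ℝ) hb v
  unfold chartDeriv at h
  rw [h, map_zero] at this
  exact this.symm

/-- This is all that the cone field requires of the regularity of the metric; it follows from
continuous differentiability in coordinates. -/
theorem exists_lipschitzOnWith_chartForm (g : LorentzianMetric n M) (p : M) :
    ∃ L, ∃ s ∈ 𝓝 (extChartAt (𝓡 (n + 1)) p p), LipschitzOnWith L (chartForm g p) s := by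
  have h1 := ((contMDiffAt_hom_bundle _).1 (g.smooth p)).2
  have h2 := (h1.of_le (m := 1) (by simp))
  have h3 : ContMDiffAt 𝓘(ℝ, EuclideanSpace ℝ (Fin (n + 1)))
      𝓘(ℝ, EuclideanSpace ℝ (Fin (n + 1)) →L[ℝ] EuclideanSpace ℝ (Fin (n + 1)) →L[ℝ] ℝ) 1
      (chartForm g p) (extChartAt (𝓡 (n + 1)) p p) := by
    have h4 : ContMDiffAt 𝓘(ℝ, EuclideanSpace ℝ (Fin (n + 1))) (𝓡 (n + 1)) 1
        (extChartAt (𝓡 (n + 1)) p).symm (extChartAt (𝓡 (n + 1)) p p) := by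
      have := (contMDiffOn_extChartAt_symm (I := 𝓡 (n + 1)) (n := ∞) p).contMDiffAt
        ((isOpen_extChartAt_target p).mem_nhds (mem_extChartAt_target p))
      exact this.of_le (by simp)
    exact ContMDiffAt.comp_of_eq h2 h4 (extChartAt_to_inv p)
  exact h3.contDiffAt.exists_lipschitzOnWith

theorem continuousAt_chartDeriv_field (T : TimeOrientation g) (p : M) :
    ContinuousAt (fun x ↦ chartDeriv p x (T.field x)) p := by
  have h := ((FiberBundle.continuousAt_totalSpace
    (EuclideanSpace ℝ (Fin (n + 1))) (E := (TangentSpace (𝓡 (n + 1)) : M → Type _)) _).1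
      (T.continuous.continuousAt (x := p))).2
  refine h.congr ?_
  filter_upwards [(trivializationAt (EuclideanSpace ℝ (Fin (n + 1)))
    (TangentSpace (𝓡 (n + 1)) : M → Type _) p).open_baseSet.mem_nhds
      (FiberBundle.mem_baseSet_trivializationAt' p)] with x hx
  unfold chartDeriv
  rw [Bundle.Trivialization.continuousLinearMapAt_apply,
    Bundle.Trivialization.coe_linearMapAt_of_mem _ hx]

/-- The cones of the metric, read in the chart centred at `p`, form a Lipschitz cone field on the
coordinate ball of radius `R`. -/
structure IsConeChart (T : TimeOrientation g) (p : M) (R K : ℝ)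
    (f : EuclideanSpace ℝ (Fin (n + 1)) →L[ℝ] ℝ) (e : EuclideanSpace ℝ (Fin (n + 1))) : Prop where
  pos : 0 < R
  ball_subset : Metric.ball (extChartAt (𝓡 (n + 1)) p p) R ⊆ (extChartAt (𝓡 (n + 1)) p).target
  continuousOn : ContinuousOn (chartForm g p) (Metric.ball (extChartAt (𝓡 (n + 1)) p p) R)
  coneField : IsLipschitzConeField (Metric.ball (extChartAt (𝓡 (n + 1)) p p) R)
    (fun z ↦ formCone (chartForm g p z) f) f e K
  axis_timelike : ∀ z ∈ Metric.ball (extChartAt (𝓡 (n + 1)) p p) R, chartForm g p z e e < 0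
  axis_pos : 0 < f e
  chartForm_symm : ∀ z ∈ Metric.ball (extChartAt (𝓡 (n + 1)) p p) R, ∀ v w,
    chartForm g p z v w = chartForm g p z w v
  norm_le_abs : ∀ z ∈ Metric.ball (extChartAt (𝓡 (n + 1)) p p) R, ∀ v,
    chartForm g p z v v ≤ 0 → ‖v‖ ≤ |f v|
  apply_field_neg_iff : ∀ x ∈ (extChartAt (𝓡 (n + 1)) p).source,
    extChartAt (𝓡 (n + 1)) p x ∈ Metric.ball (extChartAt (𝓡 (n + 1)) p p) R →
    ∀ v : TangentSpace (𝓡 (n + 1)) x, v ≠ 0 → g.val x v v ≤ 0 →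
      (g.val x (T.field x) v < 0 ↔ 0 < f (chartDeriv p x v))

/-- The functional `f` is positive on the orientation field near `p`. By `causal_apply_neg_iff` it
therefore selects the same half of each cone as the time orientation. -/
theorem exists_isConeChart (T : TimeOrientation g) (p : M) :
    ∃ (R K : ℝ) (f : EuclideanSpace ℝ (Fin (n + 1)) →L[ℝ] ℝ) (e : EuclideanSpace ℝ (Fin (n + 1))),
      IsConeChart T p R K f e := by
  set φ := extChartAt (𝓡 (n + 1)) p with hφ
  have hmem : ∀ z ∈ φ.target, φ.symm z ∈ φ.source ∧ φ (φ.symm z) = z := fun z hz ↦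
    ⟨φ.map_target hz, φ.right_inv hz⟩
  have hp : p ∈ φ.source := mem_extChartAt_source p
  have hsymm : ∀ z ∈ φ.target, ∀ v w, chartForm g p z v w = chartForm g p z w v := by
    intro z hz v w
    obtain ⟨h1, h2⟩ := hmem z hz
    obtain ⟨v', rfl⟩ := chartDeriv_surjective h1 v
    obtain ⟨w', rfl⟩ := chartDeriv_surjective h1 w
    rw [← h2, φ.left_inv h1, chartForm_chartDeriv h1, chartForm_chartDeriv h1, g.symm]
  let τ := fun z ↦ chartDeriv p (φ.symm z) (T.field (φ.symm z))
  have hτ : ContinuousAt τ (φ p) := by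
    refine ContinuousAt.comp_of_eq (continuousAt_chartDeriv_field T p)
      (continuousAt_extChartAt_symm p) (extChartAt_to_inv p)
  have hτφ : ∀ x ∈ φ.source, τ (φ x) = chartDeriv p x (T.field x) := by
    intro x hx
    simp only [τ]
    rw [φ.left_inv hx]
  obtain ⟨R, hR, K, f, e, hb, hc, hC, hall⟩ :=
    exists_isLipschitzConeField (G := chartForm g p) (τ := τ) (z₀ := φ p)
      ((isOpen_extChartAt_target p).mem_nhds (mem_extChartAt_target p)) hsymm
      (exists_lipschitzOnWith_chartForm g p) hτ
      (by rw [hτφ p hp, chartForm_chartDeriv hp]; exact T.timelike p)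
      (by
        intro v hv0 hv
        obtain ⟨v, rfl⟩ := chartDeriv_surjective hp v
        rw [chartForm_chartDeriv hp] at hv
        rw [hτφ p hp, chartForm_chartDeriv hp]
        exact ne_zero_of_timelike_of_causal (g.val p) (g.symm p) (g.signature p) (T.timelike p)
          (fun h ↦ hv0 (by rw [h, map_zero])) hv)
  refine ⟨R, K, f, e, hR, hb, hc, hC, fun z hz ↦ (hall z hz).2.1,
    (hall _ (Metric.mem_ball_self hR)).2.2.1, fun z hz ↦ hsymm z (hb hz),
    fun z hz ↦ (hall z hz).1, ?_⟩
  intro x hx hxB v hv0 hv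
  obtain ⟨h1, -, -, h4⟩ := hall _ hxB
  rw [hτφ x hx] at h4
  rw [← chartForm_chartDeriv hx] at hv ⊢
  refine causal_apply_neg_iff (hsymm _ (hb hxB)) h1 ?_ h4 ?_ hv
  · rw [chartForm_chartDeriv hx]
    exact T.timelike x
  · rwa [Ne, chartDeriv_eq_zero_iff hx]

namespace IsConeChart

variable {T : TimeOrientation g} {p : M} {R K : ℝ}
  {f : EuclideanSpace ℝ (Fin (n + 1)) →L[ℝ] ℝ} {e : EuclideanSpace ℝ (Fin (n + 1))}

theorem isFutureCausal_iff (h : IsConeChart T p R K f e) {x : M}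
    (hx : x ∈ (extChartAt (𝓡 (n + 1)) p).source)
    (hxB : extChartAt (𝓡 (n + 1)) p x ∈ Metric.ball (extChartAt (𝓡 (n + 1)) p p) R)
    {v : TangentSpace (𝓡 (n + 1)) x} :
    IsFutureCausal T x v ↔
      chartForm g p (extChartAt (𝓡 (n + 1)) p x) (chartDeriv p x v) (chartDeriv p x v) ≤ 0 ∧
        0 < f (chartDeriv p x v) := by
  rw [chartForm_chartDeriv hx]
  constructor
  · rintro ⟨h1, h2, h3⟩
    exact ⟨h2, (h.apply_field_neg_iff x hx hxB v h1 h2).1 h3⟩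
  · rintro ⟨h2, h3⟩
    have h1 : v ≠ 0 := by rintro rfl; simp at h3
    exact ⟨h1, h2, (h.apply_field_neg_iff x hx hxB v h1 h2).2 h3⟩

theorem isFutureTimelike_iff (h : IsConeChart T p R K f e) {x : M}
    (hx : x ∈ (extChartAt (𝓡 (n + 1)) p).source)
    (hxB : extChartAt (𝓡 (n + 1)) p x ∈ Metric.ball (extChartAt (𝓡 (n + 1)) p p) R)
    {v : TangentSpace (𝓡 (n + 1)) x} :
    IsFutureTimelike T x v ↔
      chartForm g p (extChartAt (𝓡 (n + 1)) p x) (chartDeriv p x v) (chartDeriv p x v) < 0 ∧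
        0 < f (chartDeriv p x v) := by
  rw [chartForm_chartDeriv hx]
  have h1 : g.val x v v < 0 → v ≠ 0 := by rintro h rfl; simp at h
  constructor
  · rintro ⟨h2, h3⟩
    exact ⟨h2, (h.apply_field_neg_iff x hx hxB v (h1 h2) h2.le).1 h3⟩
  · rintro ⟨h2, h3⟩
    exact ⟨h2, (h.apply_field_neg_iff x hx hxB v (h1 h2) h2.le).2 h3⟩

/-- Adding a positive multiple of the axis makes a causal vector timelike. -/
theorem add_smul_axis_timelike (h : IsConeChart T p R K f e)
    {z : EuclideanSpace ℝ (Fin (n + 1))}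
    (hz : z ∈ Metric.ball (extChartAt (𝓡 (n + 1)) p p) R) {v : EuclideanSpace ℝ (Fin (n + 1))}
    (hv : v ∈ formCone (chartForm g p z) f) {c : ℝ} (hc : 0 < c) :
    chartForm g p z (v + c • e) (v + c • e) < 0 ∧ 0 < f (v + c • e) := by
  have h1 := formCone_apply_nonpos (h.chartForm_symm z hz) (h.norm_le_abs z hz) hv
    (h.coneField.axis_mem z hz)
  have h2 := h.axis_timelike z hz
  have e1 : chartForm g p z (v + c • e) (v + c • e) =
      chartForm g p z v v + 2 * (c * chartForm g p z v e) + c * c * chartForm g p z e e := by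
    simp only [map_add, map_smul, add_apply, smul_apply, smul_eq_mul, h.chartForm_symm z hz e v]
    ring
  constructor
  · rw [e1]
    have e2 := mul_neg_of_pos_of_neg (mul_pos hc hc) h2
    have e3 := mul_nonpos_of_nonneg_of_nonpos hc.le h1
    linarith [hv.1]
  · rw [map_add, map_smul, smul_eq_mul]
    have := mul_pos hc h.axis_pos
    linarith [hv.2]

end IsConeChart

omit [IsManifold (𝓡 (n + 1)) ∞ M] in
theorem extChartAt_symm_mem_source {p : M} {z : EuclideanSpace ℝ (Fin (n + 1))}
    (hz : z ∈ (extChartAt (𝓡 (n + 1)) p).target) :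
    (extChartAt (𝓡 (n + 1)) p).symm z ∈ (extChartAt (𝓡 (n + 1)) p).source :=
  (extChartAt (𝓡 (n + 1)) p).map_target hz

theorem chartDeriv_eq_mfderiv {p x : M} (hx : x ∈ (extChartAt (𝓡 (n + 1)) p).source) :
    chartDeriv p x = mfderiv (𝓡 (n + 1)) 𝓘(ℝ, EuclideanSpace ℝ (Fin (n + 1)))
      (extChartAt (𝓡 (n + 1)) p) x := by
  rw [extChartAt_source] at hx
  exact TangentBundle.continuousLinearMapAt_trivializationAt hx

theorem hasDerivWithinAt_extChartAt_comp {γ : ℝ → M} {s : Set ℝ} {t : ℝ} {p : M}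
    (hγ : MDifferentiableWithinAt 𝓘(ℝ, ℝ) (𝓡 (n + 1)) γ s t)
    (hp : γ t ∈ (extChartAt (𝓡 (n + 1)) p).source) :
    HasDerivWithinAt (fun τ ↦ extChartAt (𝓡 (n + 1)) p (γ τ))
      (chartDeriv p (γ t) (mfderivWithin 𝓘(ℝ, ℝ) (𝓡 (n + 1)) γ s t (1 : ℝ))) s t := by
  have h1 : HasMFDerivAt (𝓡 (n + 1)) 𝓘(ℝ, EuclideanSpace ℝ (Fin (n + 1)))
      (extChartAt (𝓡 (n + 1)) p) (γ t) (chartDeriv p (γ t)) := by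
    rw [chartDeriv_eq_mfderiv hp]
    exact (mdifferentiableAt_extChartAt (by rwa [extChartAt_source] at hp)).hasMFDerivAt
  have h2 := h1.comp_hasMFDerivWithinAt t hγ.hasMFDerivWithinAt
  let A : ℝ →L[ℝ] EuclideanSpace ℝ (Fin (n + 1)) :=
    (chartDeriv p (γ t)).comp (mfderivWithin 𝓘(ℝ, ℝ) (𝓡 (n + 1)) γ s t)
  have h3 : HasFDerivWithinAt (fun τ ↦ extChartAt (𝓡 (n + 1)) p (γ τ)) A s t :=
    h2.hasFDerivWithinAt
  exact h3.hasDerivWithinAt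

theorem hasDerivAt_extChartAt_comp {γ : ℝ → M} {t : ℝ} {p : M}
    (hγ : MDifferentiableAt 𝓘(ℝ, ℝ) (𝓡 (n + 1)) γ t)
    (hp : γ t ∈ (extChartAt (𝓡 (n + 1)) p).source) :
    HasDerivAt (fun τ ↦ extChartAt (𝓡 (n + 1)) p (γ τ))
      (chartDeriv p (γ t) (mfderiv 𝓘(ℝ, ℝ) (𝓡 (n + 1)) γ t (1 : ℝ))) t := by
  rw [← mfderivWithin_univ, ← hasDerivWithinAt_univ]
  exact hasDerivWithinAt_extChartAt_comp (mdifferentiableWithinAt_univ.2 hγ) hp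

theorem mdifferentiableAt_extChartAt_symm_comp {σ : ℝ → EuclideanSpace ℝ (Fin (n + 1))} {t : ℝ}
    {v : EuclideanSpace ℝ (Fin (n + 1))} {p : M} (hσ : HasDerivAt σ v t)
    (hp : σ t ∈ (extChartAt (𝓡 (n + 1)) p).target) :
    MDifferentiableAt 𝓘(ℝ, ℝ) (𝓡 (n + 1)) (fun τ ↦ (extChartAt (𝓡 (n + 1)) p).symm (σ τ)) t ∧
      chartDeriv p ((extChartAt (𝓡 (n + 1)) p).symm (σ t)) (mfderiv 𝓘(ℝ, ℝ) (𝓡 (n + 1))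
        (fun τ ↦ (extChartAt (𝓡 (n + 1)) p).symm (σ τ)) t (1 : ℝ)) = v := by
  have h1 : MDifferentiableAt 𝓘(ℝ, EuclideanSpace ℝ (Fin (n + 1))) (𝓡 (n + 1))
      (extChartAt (𝓡 (n + 1)) p).symm (σ t) :=
    (mdifferentiableOn_extChartAt_symm (σ t) hp).mdifferentiableAt
      ((isOpen_extChartAt_target p).mem_nhds hp)
  have h2 : MDifferentiableAt 𝓘(ℝ, ℝ) (𝓡 (n + 1))
      (fun τ ↦ (extChartAt (𝓡 (n + 1)) p).symm (σ τ)) t :=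
    h1.comp t hσ.differentiableAt.mdifferentiableAt
  refine ⟨h2, ?_⟩
  have h3 := hasDerivAt_extChartAt_comp (p := p) h2 (extChartAt_symm_mem_source hp)
  refine (h3.congr_of_eventuallyEq ?_).unique hσ
  filter_upwards [hσ.continuousAt.preimage_mem_nhds
    ((isOpen_extChartAt_target p).mem_nhds hp)] with τ hτ
  exact ((extChartAt (𝓡 (n + 1)) p).right_inv hτ).symm

/-- The Lipschitz condition of a locally Lipschitz curve can be read in any chart. -/
theorem IsLocallyLipschitzCurveOn.extChartAt_comp {γ : ℝ → M} {s : Set ℝ}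
    (hγ : IsLocallyLipschitzCurveOn n γ s) {p : M} {s' : Set ℝ} (hs : s' ⊆ s)
    (hp : ∀ t ∈ s', γ t ∈ (extChartAt (𝓡 (n + 1)) p).source) :
    LocallyLipschitzOn s' (fun τ ↦ extChartAt (𝓡 (n + 1)) p (γ τ)) := by
  intro t ht
  obtain ⟨L, u, hu, hL⟩ := hγ.2 t (hs ht)
  have hsrc := hp t ht
  have h0 := mem_extChartAt_source (I := 𝓡 (n + 1)) (γ t)
  have h1 : ContDiffAt ℝ 1 (extChartAt (𝓡 (n + 1)) p ∘ (extChartAt (𝓡 (n + 1)) (γ t)).symm)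
      (extChartAt (𝓡 (n + 1)) (γ t) (γ t)) := by
    have a1 : ContMDiffAt (𝓡 (n + 1)) 𝓘(ℝ, EuclideanSpace ℝ (Fin (n + 1))) ∞
        (extChartAt (𝓡 (n + 1)) p) (γ t) :=
      contMDiffAt_extChartAt' (by rwa [extChartAt_source] at hsrc)
    have a2 := (contMDiffOn_extChartAt_symm (I := 𝓡 (n + 1)) (n := ∞) (γ t)).contMDiffAt
      ((isOpen_extChartAt_target (γ t)).mem_nhds (mem_extChartAt_target (γ t)))
    exact ((ContMDiffAt.comp_of_eq a1 a2 (extChartAt_to_inv (γ t))).contDiffAt).of_le (by simp)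
  obtain ⟨L', w, hw, hL'⟩ := h1.exists_lipschitzOnWith
  have hcont : ContinuousWithinAt γ s t := hγ.1 t (hs ht)
  have hw' : (fun τ ↦ extChartAt (𝓡 (n + 1)) (γ t) (γ τ)) ⁻¹' w ∈ 𝓝[s] t :=
    ((continuousAt_extChartAt (γ t)).comp_continuousWithinAt hcont) hw
  have hsrc' : γ ⁻¹' (extChartAt (𝓡 (n + 1)) (γ t)).source ∈ 𝓝[s] t :=
    hcont ((isOpen_extChartAt_source (γ t)).mem_nhds h0)
  refine ⟨L' * L, u ∩ ((fun τ ↦ extChartAt (𝓡 (n + 1)) (γ t) (γ τ)) ⁻¹' w ∩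
    γ ⁻¹' (extChartAt (𝓡 (n + 1)) (γ t)).source),
    nhdsWithin_mono _ hs (inter_mem hu (inter_mem hw' hsrc')), ?_⟩
  have h2 := hL'.comp (hL.mono (inter_subset_left (t :=
    (fun τ ↦ extChartAt (𝓡 (n + 1)) (γ t) (γ τ)) ⁻¹' w ∩
      γ ⁻¹' (extChartAt (𝓡 (n + 1)) (γ t)).source))) (fun τ hτ ↦ hτ.2.1)
  refine fun x hx y hy ↦ ?_
  have := h2 hx hy
  simp only [Function.comp_apply] at this
  rwa [(extChartAt (𝓡 (n + 1)) (γ t)).left_inv hx.2.2,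
    (extChartAt (𝓡 (n + 1)) (γ t)).left_inv hy.2.2] at this

theorem isLocallyLipschitzCurveOn_extChartAt_symm_comp
    {σ : ℝ → EuclideanSpace ℝ (Fin (n + 1))} {s : Set ℝ} {p : M} {L : NNReal}
    (hσ : LipschitzOnWith L σ s) (hp : ∀ t ∈ s, σ t ∈ (extChartAt (𝓡 (n + 1)) p).target) :
    IsLocallyLipschitzCurveOn n (fun τ ↦ (extChartAt (𝓡 (n + 1)) p).symm (σ τ)) s := by
  refine ⟨(continuousOn_extChartAt_symm p).comp hσ.continuousOn hp, fun t ht ↦ ?_⟩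
  have hsrc := extChartAt_symm_mem_source (hp t ht)
  set x := (extChartAt (𝓡 (n + 1)) p).symm (σ t)
  have h1 : ContDiffAt ℝ 1 (extChartAt (𝓡 (n + 1)) x ∘ (extChartAt (𝓡 (n + 1)) p).symm)
      (σ t) := by
    have a1 : ContMDiffAt (𝓡 (n + 1)) 𝓘(ℝ, EuclideanSpace ℝ (Fin (n + 1))) ∞
        (extChartAt (𝓡 (n + 1)) x) x := contMDiffAt_extChartAt
    have a2 := (contMDiffOn_extChartAt_symm (I := 𝓡 (n + 1)) (n := ∞) p).contMDiffAt
      ((isOpen_extChartAt_target p).mem_nhds (hp t ht))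
    exact ((ContMDiffAt.comp_of_eq a1 a2 rfl).contDiffAt).of_le (by simp)
  obtain ⟨L', w, hw, hL'⟩ := h1.exists_lipschitzOnWith
  refine ⟨L' * L, s ∩ σ ⁻¹' w, inter_mem self_mem_nhdsWithin (hσ.continuousOn t ht hw), ?_⟩
  exact hL'.comp (hσ.mono inter_subset_left) (fun τ hτ ↦ hτ.2)

end Chart

/-! ### Restriction, reparametrization and concatenation of curves -/

section Curves

variable {n : ℕ} {M : Type*} [TopologicalSpace M]
  [ChartedSpace (EuclideanSpace ℝ (Fin (n + 1))) M] [IsManifold (𝓡 (n + 1)) ∞ M]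
  {g : LorentzianMetric n M}

/-- A locally Lipschitz curve whose velocity satisfies `P` almost everywhere. -/
def HasVelocityInOn (P : ∀ x : M, TangentSpace (𝓡 (n + 1)) x → Prop) (γ : ℝ → M) (s : Set ℝ) :
    Prop :=
  IsLocallyLipschitzCurveOn n γ s ∧
    ∀ᵐ t ∂(volume.restrict s), MDifferentiableAt 𝓘(ℝ, ℝ) (𝓡 (n + 1)) γ t ∧
      P (γ t) (mfderiv 𝓘(ℝ, ℝ) (𝓡 (n + 1)) γ t (1 : ℝ))

omit [IsManifold (𝓡 (n + 1)) ∞ M] in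
theorem IsLocallyLipschitzCurveOn.mono {γ : ℝ → M} {s t : Set ℝ}
    (h : IsLocallyLipschitzCurveOn n γ s) (hts : t ⊆ s) : IsLocallyLipschitzCurveOn n γ t := by
  refine ⟨h.1.mono hts, fun x hx ↦ ?_⟩
  obtain ⟨L, u, hu, hL⟩ := h.2 x (hts hx)
  exact ⟨L, u, nhdsWithin_mono _ hts hu, hL⟩

omit [IsManifold (𝓡 (n + 1)) ∞ M] in
theorem IsLocallyLipschitzCurveOn.congr {γ δ : ℝ → M} {s : Set ℝ}
    (h : IsLocallyLipschitzCurveOn n γ s) (hγδ : EqOn δ γ s) :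
    IsLocallyLipschitzCurveOn n δ s := by
  refine ⟨h.1.congr hγδ, fun x hx ↦ ?_⟩
  obtain ⟨L, u, hu, hL⟩ := h.2 x hx
  refine ⟨L, u ∩ s, inter_mem hu self_mem_nhdsWithin, fun y hy z hz ↦ ?_⟩
  simp only [hγδ hx, hγδ hy.2, hγδ hz.2]
  exact hL hy.1 hz.1

namespace HasVelocityInOn

variable {P : ∀ x : M, TangentSpace (𝓡 (n + 1)) x → Prop}

omit [IsManifold (𝓡 (n + 1)) ∞ M] in
theorem mono {γ : ℝ → M} {s t : Set ℝ} (h : HasVelocityInOn P γ s) (hts : t ⊆ s) :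
    HasVelocityInOn P γ t :=
  ⟨h.1.mono hts, ae_restrict_of_ae_restrict_of_subset hts h.2⟩

omit [IsManifold (𝓡 (n + 1)) ∞ M] in
theorem congr {γ δ : ℝ → M} {a b : ℝ} (h : HasVelocityInOn P γ (Icc a b))
    (hγδ : EqOn δ γ (Icc a b)) : HasVelocityInOn P δ (Icc a b) := by
  refine ⟨h.1.congr hγδ, ?_⟩
  have h2 := h.2
  -- Agreement on the closed interval does not control the two-sided derivative at its end points;
  -- these form a null set.
  rw [← restrict_Ioo_eq_restrict_Icc, ae_restrict_iff' measurableSet_Ioo] at h2 ⊢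
  filter_upwards [h2] with t ht htI
  obtain ⟨h3, h4⟩ := ht htI
  have he : δ =ᶠ[𝓝 t] γ := by
    filter_upwards [Ioo_mem_nhds htI.1 htI.2] with τ hτ
    exact hγδ (Ioo_subset_Icc_self hτ)
  refine ⟨h3.congr_of_eventuallyEq he, ?_⟩
  have key : ∀ x y : M, x = y → ∀ v w : EuclideanSpace ℝ (Fin (n + 1)), v = w →
      P x v → P y w := by
    rintro x y rfl v w rfl h
    exact h
  refine key _ _ he.eq_of_nhds.symm _ _ ?_ h4
  rw [he.mfderiv_eq]
  rfl

-- At the junction both Lipschitz conditions are read in the same chart, and they add up since `b`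
-- lies between parameters taken from the two sides.
omit [IsManifold (𝓡 (n + 1)) ∞ M] in
theorem union {γ : ℝ → M} {a b c : ℝ} (h₁ : HasVelocityInOn P γ (Icc a b))
    (h₂ : HasVelocityInOn P γ (Icc b c)) (hab : a ≤ b) (hbc : b ≤ c) :
    HasVelocityInOn P γ (Icc a c) := by
  have hU : Icc a b ∪ Icc b c = Icc a c := Icc_union_Icc_eq_Icc hab hbc
  refine ⟨⟨?_, ?_⟩, ?_⟩
  · rw [← hU]
    exact h₁.1.1.union_of_isClosed h₂.1.1 isClosed_Icc isClosed_Icc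
  · intro t ht
    rcases lt_trichotomy t b with hlt | rfl | hlt
    · obtain ⟨L, u, hu, hL⟩ := h₁.1.2 t ⟨ht.1, hlt.le⟩
      refine ⟨L, u, ?_, hL⟩
      rw [← hU, nhdsWithin_union]
      refine mem_sup.2 ⟨hu, ?_⟩
      rw [notMem_closure_iff_nhdsWithin_eq_bot.1]
      · exact mem_bot
      · rw [closure_Icc]
        exact fun h ↦ absurd h.1 (not_le.2 hlt)
    · obtain ⟨L, u, hu, hL⟩ := h₁.1.2 t ⟨hab, le_rfl⟩
      obtain ⟨L', u', hu', hL'⟩ := h₂.1.2 t ⟨le_rfl, hbc⟩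
      have htu : t ∈ u := mem_of_mem_nhdsWithin (show t ∈ Icc a t from ⟨hab, le_rfl⟩) hu
      have htu' : t ∈ u' := mem_of_mem_nhdsWithin (show t ∈ Icc t c from ⟨le_rfl, hbc⟩) hu'
      refine ⟨max L L', (u ∩ Icc a t) ∪ (u' ∩ Icc t c), ?_, ?_⟩
      · rw [← hU, nhdsWithin_union]
        exact mem_sup.2 ⟨mem_of_superset (inter_mem hu self_mem_nhdsWithin) subset_union_left,
          mem_of_superset (inter_mem hu' self_mem_nhdsWithin) subset_union_right⟩
      · have hM1 := hL.weaken (le_max_left L L')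
        have hM2 := hL'.weaken (le_max_right L L')
        have hcross : ∀ x ∈ u ∩ Icc a t, ∀ y ∈ u' ∩ Icc t c,
            dist (extChartAt (𝓡 (n + 1)) (γ t) (γ x)) (extChartAt (𝓡 (n + 1)) (γ t) (γ y)) ≤
              (max L L' : NNReal) * dist x y := by
          intro x hx y hy
          have e1 := hM1.dist_le_mul x hx.1 t htu
          have e2 := hM2.dist_le_mul t htu' y hy.1
          have e3 : dist x t + dist t y = dist x y := by
            rw [Real.dist_eq, Real.dist_eq, Real.dist_eq, abs_of_nonpos (sub_nonpos.2 hx.2.2),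
              abs_of_nonpos (sub_nonpos.2 hy.2.1), abs_of_nonpos
                (sub_nonpos.2 (hx.2.2.trans hy.2.1))]
            ring
          rw [← e3, mul_add]
          exact (dist_triangle _ _ _).trans (add_le_add e1 e2)
        refine LipschitzOnWith.of_dist_le_mul fun x hx y hy ↦ ?_
        rcases hx with hx | hx <;> rcases hy with hy | hy
        · exact hM1.dist_le_mul x hx.1 y hy.1
        · exact hcross x hx y hy
        · rw [dist_comm, dist_comm x]
          exact hcross y hy x hx
        · exact hM2.dist_le_mul x hx.1 y hy.1
    · obtain ⟨L, u, hu, hL⟩ := h₂.1.2 t ⟨hlt.le, ht.2⟩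
      refine ⟨L, u, ?_, hL⟩
      rw [← hU, nhdsWithin_union]
      refine mem_sup.2 ⟨?_, hu⟩
      rw [notMem_closure_iff_nhdsWithin_eq_bot.1]
      · exact mem_bot
      · rw [closure_Icc]
        exact fun h ↦ absurd h.2 (not_le.2 hlt)
  · rw [← hU, ae_restrict_union_iff]
    exact ⟨h₁.2, h₂.2⟩

omit [IsManifold (𝓡 (n + 1)) ∞ M] in
theorem comp_affine {Q : ∀ x : M, TangentSpace (𝓡 (n + 1)) x → Prop} {γ : ℝ → M} {s : Set ℝ}
    (h : HasVelocityInOn P γ s) (hs : MeasurableSet s) {c : ℝ} (hc : c ≠ 0) (d : ℝ)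
    (hPQ : ∀ x v, P x v → Q x (c • v)) :
    HasVelocityInOn Q (fun t ↦ γ (c * t + d)) ((fun t ↦ c * t + d) ⁻¹' s) := by
  have hcont : Continuous fun t : ℝ ↦ c * t + d := by fun_prop
  have hlip : LipschitzWith ‖c‖₊ fun t : ℝ ↦ c * t + d := by
    refine LipschitzWith.of_dist_le_mul fun x y ↦ ?_
    rw [Real.dist_eq, Real.dist_eq, add_sub_add_right_eq_sub, ← mul_sub, abs_mul]
    rfl
  refine ⟨⟨h.1.1.comp hcont.continuousOn fun t ht ↦ ht, fun t ht ↦ ?_⟩, ?_⟩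
  · obtain ⟨L, u, hu, hL⟩ := h.1.2 _ ht
    refine ⟨L * ‖c‖₊, (fun t ↦ c * t + d) ⁻¹' u, ?_, ?_⟩
    · exact (hcont.continuousWithinAt.tendsto_nhdsWithin fun t ht ↦ ht) hu
    · exact hL.comp hlip.lipschitzOnWith fun t ht ↦ ht
  · have hq : Measure.QuasiMeasurePreserving (fun t : ℝ ↦ c * t + d) volume volume := by
      have h1 : Measure.QuasiMeasurePreserving (fun t : ℝ ↦ c * t) volume volume := by
        refine ⟨by fun_prop, ?_⟩
        rw [Real.map_volume_mul_left hc]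
        exact Measure.smul_absolutelyContinuous
      exact ((measurePreserving_add_right volume d).quasiMeasurePreserving).comp h1
    have h2 := h.2
    rw [ae_restrict_iff' hs] at h2
    rw [ae_restrict_iff' (hcont.measurable hs)]
    filter_upwards [hq.ae h2] with t ht hts
    obtain ⟨h3, h4⟩ := ht hts
    have hA : HasMFDerivAt 𝓘(ℝ, ℝ) 𝓘(ℝ, ℝ) (fun t : ℝ ↦ c * t + d) t
        (c • ContinuousLinearMap.id ℝ ℝ) := by
      have : HasFDerivAt (fun t : ℝ ↦ c * t + d) (c • ContinuousLinearMap.id ℝ ℝ) t :=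
        ((hasFDerivAt_id t).const_smul c).add_const d
      exact this.hasMFDerivAt
    have hcomp := HasMFDerivAt.comp (x := t) (f := fun t : ℝ ↦ c * t + d) (g := γ)
      h3.hasMFDerivAt hA
    refine ⟨hcomp.mdifferentiableAt, ?_⟩
    have h5 := hPQ _ _ h4
    have h6 : mfderiv 𝓘(ℝ, ℝ) (𝓡 (n + 1)) (fun t ↦ γ (c * t + d)) t (1 : ℝ) =
        c • mfderiv 𝓘(ℝ, ℝ) (𝓡 (n + 1)) γ (c * t + d) (1 : ℝ) := by
      have h7 := hcomp.mfderiv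
      have h8 : mfderiv 𝓘(ℝ, ℝ) (𝓡 (n + 1)) (fun t ↦ γ (c * t + d)) t =
        (mfderiv 𝓘(ℝ, ℝ) (𝓡 (n + 1)) γ (c * t + d)).comp (c • ContinuousLinearMap.id ℝ ℝ) := h7
      rw [h8]
      exact (mfderiv 𝓘(ℝ, ℝ) (𝓡 (n + 1)) γ (c * t + d)).map_smul c (1 : ℝ)
    rw [h6]
    exact h5

end HasVelocityInOn

theorem isFutureCausal_smul {T : TimeOrientation g} {x : M} {v : TangentSpace (𝓡 (n + 1)) x}
    (h : IsFutureCausal T x v) {c : ℝ} (hc : 0 < c) : IsFutureCausal T x (c • v) := by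
  refine ⟨smul_ne_zero hc.ne' h.1, ?_, ?_⟩
  · have : g.val x (c • v) (c • v) = c * c * g.val x v v := by
      simp only [map_smul, smul_apply, smul_eq_mul]
      ring
    rw [this]
    exact mul_nonpos_of_nonneg_of_nonpos (mul_pos hc hc).le h.2.1
  · rw [map_smul, smul_eq_mul]
    exact mul_neg_of_pos_of_neg hc h.2.2

theorem isPastCausal_smul_of_neg {T : TimeOrientation g} {x : M} {v : TangentSpace (𝓡 (n + 1)) x}
    (h : IsFutureCausal T x v) {c : ℝ} (hc : c < 0) : IsPastCausal T x (c • v) := by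
  refine ⟨smul_ne_zero hc.ne h.1, ?_, ?_⟩
  · have : g.val x (c • v) (c • v) = c * c * g.val x v v := by
      simp only [map_smul, smul_apply, smul_eq_mul]
      ring
    rw [this]
    exact mul_nonpos_of_nonneg_of_nonpos (mul_pos_of_neg_of_neg hc hc).le h.2.1
  · rw [map_smul, smul_eq_mul]
    exact mul_pos_of_neg_of_neg hc h.2.2

/-- A causal curve can be reparametrized on any given parameter interval. -/
theorem IsFutureCausalCurveOn.exists_reparam {T : TimeOrientation g} {γ : ℝ → M} {a b : ℝ} (hab : a < b)
    (h : IsFutureCausalCurveOn T γ (Icc a b)) {a' b' : ℝ} (hab' : a' < b') :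
    ∃ δ : ℝ → M, IsFutureCausalCurveOn T δ (Icc a' b') ∧ δ a' = γ a ∧ δ b' = γ b ∧
      ∀ t ∈ Icc a' b', ∃ t' ∈ Icc a b, δ t = γ t' := by
  set c := (b - a) / (b' - a') with hc
  have hc0 : 0 < c := div_pos (sub_pos.2 hab) (sub_pos.2 hab')
  have hcm : c * (b' - a') = b - a := div_mul_cancel₀ _ (sub_pos.2 hab').ne'
  have hmaps : ∀ t ∈ Icc a' b', c * t + (a - c * a') ∈ Icc a b := by
    intro t ht
    constructor
    · have := mul_le_mul_of_nonneg_left ht.1 hc0.le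
      linarith
    · have := mul_le_mul_of_nonneg_left ht.2 hc0.le
      linarith
  refine ⟨fun t ↦ γ (c * t + (a - c * a')), ?_, ?_, ?_, fun t ht ↦ ⟨_, hmaps t ht, rfl⟩⟩
  · exact (HasVelocityInOn.comp_affine (P := IsFutureCausal T) (Q := IsFutureCausal T) h
      measurableSet_Icc hc0.ne' (a - c * a') fun x v hv ↦ isFutureCausal_smul hv hc0).mono hmaps
  · simp only
    congr 1
    ring
  · simp only
    congr 1
    linarith

/-- Concatenation of two causal curves. -/
theorem IsFutureCausalCurveOn.exists_concat {T : TimeOrientation g} {γ δ : ℝ → M} {a b c d : ℝ} (hab : a < b)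
    (hcd : c < d) (hγ : IsFutureCausalCurveOn T γ (Icc a b))
    (hδ : IsFutureCausalCurveOn T δ (Icc c d)) (hγδ : γ b = δ c) :
    ∃ (e : ℝ) (ρ : ℝ → M), a < e ∧ IsFutureCausalCurveOn T ρ (Icc a e) ∧ ρ a = γ a ∧ ρ e = δ d ∧
      ∀ t ∈ Icc a e, (∃ t' ∈ Icc a b, ρ t = γ t') ∨ ∃ t' ∈ Icc c d, ρ t = δ t' := by
  obtain ⟨δ', h1, h2, h3, h4⟩ := IsFutureCausalCurveOn.exists_reparam hcd hδ (lt_add_one b)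
  let ρ : ℝ → M := fun t ↦ if t ≤ b then γ t else δ' t
  have e1 : EqOn ρ γ (Icc a b) := fun t ht ↦ if_pos ht.2
  have e2 : EqOn ρ δ' (Icc b (b + 1)) := fun t ht ↦ by
    rcases ht.1.eq_or_lt with rfl | hlt
    · simp only [ρ, le_refl, if_true, h2, hγδ]
    · exact if_neg (not_le.2 hlt)
  refine ⟨b + 1, ρ, hab.trans (lt_add_one b), ?_, e1 ⟨le_rfl, hab.le⟩, ?_, ?_⟩
  · exact (HasVelocityInOn.congr (P := IsFutureCausal T) hγ e1).union
      (HasVelocityInOn.congr (P := IsFutureCausal T) h1 e2) hab.le (by linarith)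
  · rw [e2 ⟨by linarith, le_rfl⟩, h3]
  · intro t ht
    rcases le_total t b with hle | hle
    · exact Or.inl ⟨t, ⟨ht.1, hle⟩, e1 ⟨ht.1, hle⟩⟩
    · obtain ⟨t', ht', h⟩ := h4 t ⟨hle, ht.2⟩
      exact Or.inr ⟨t', ht', (e2 ⟨hle, ht.2⟩).trans h⟩

theorem CausallyPrecedes.trans {T : TimeOrientation g} {x y z : M} (hxy : CausallyPrecedes T x y)
    (hyz : CausallyPrecedes T y z) : CausallyPrecedes T x z := by
  rcases hxy with rfl | ⟨a, b, γ, hab, rfl, rfl, hγ⟩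
  · exact hyz
  rcases hyz with rfl | ⟨c, d, δ, hcd, hc, rfl, hδ⟩
  · exact Or.inr ⟨a, b, γ, hab, rfl, rfl, hγ⟩
  obtain ⟨e, ρ, hae, hρ, h1, h2, -⟩ := IsFutureCausalCurveOn.exists_concat hab hcd hγ hδ hc.symm
  exact Or.inr ⟨a, e, ρ, hae, h1, h2, hρ⟩

theorem IsFutureCausalCurveOn.causallyPrecedes {T : TimeOrientation g} {γ : ℝ → M} {a b s t : ℝ}
    (hγ : IsFutureCausalCurveOn T γ (Icc a b)) (hs : a ≤ s) (hst : s ≤ t) (ht : t ≤ b) :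
    CausallyPrecedes T (γ s) (γ t) := by
  rcases hst.eq_or_lt with rfl | hlt
  · exact Or.inl rfl
  · exact Or.inr ⟨s, t, γ, hlt, rfl, rfl,
      HasVelocityInOn.mono (P := IsFutureCausal T) hγ (Icc_subset_Icc hs ht)⟩

end Curves

/-! ### Local causality and openness of chronological pasts -/

section LocalCausality

variable {n : ℕ} {M : Type*} [TopologicalSpace M]
  [ChartedSpace (EuclideanSpace ℝ (Fin (n + 1))) M] [IsManifold (𝓡 (n + 1)) ∞ M]
  {g : LorentzianMetric n M} {T : TimeOrientation g}

theorem IsFutureTimelike.isFutureCausal {x : M} {v : TangentSpace (𝓡 (n + 1)) x}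
    (h : IsFutureTimelike T x v) : IsFutureCausal T x v := by
  refine ⟨?_, h.1.le, h.2⟩
  rintro rfl
  simpa using h.2

namespace IsSmoothFutureTimelikeCurveOn

variable {γ : ℝ → M} {a b : ℝ}

theorem mono (h : IsSmoothFutureTimelikeCurveOn T γ (Icc a b)) {s t : ℝ} (hs : a ≤ s)
    (hst : s < t) (ht : t ≤ b) : IsSmoothFutureTimelikeCurveOn T γ (Icc s t) := by
  have hsub : Icc s t ⊆ Icc a b := Icc_subset_Icc hs ht
  refine ⟨h.1.mono hsub, fun τ hτ ↦ ?_⟩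
  have h1 := h.2 τ (hsub hτ)
  have h2 := (h.1 τ (hsub hτ)).mdifferentiableWithinAt (by simp)
  rwa [← MDifferentiableWithinAt.mfderivWithin_mono h2
    ((uniqueDiffOn_Icc hst).uniqueMDiffOn τ hτ) hsub] at h1

theorem chronologicallyPrecedes (h : IsSmoothFutureTimelikeCurveOn T γ (Icc a b)) {s t : ℝ}
    (hs : a ≤ s) (hst : s < t) (ht : t ≤ b) : ChronologicallyPrecedes T (γ s) (γ t) :=
  Relation.TransGen.single ⟨s, t, γ, hst, rfl, rfl, h.mono hs hst ht⟩

theorem isFutureCausalCurveOn (h : IsSmoothFutureTimelikeCurveOn T γ (Icc a b)) :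
    IsFutureCausalCurveOn T γ (Icc a b) := by
  refine ⟨⟨h.1.continuousOn, fun t ht ↦ ?_⟩, ?_⟩
  · have h1 : ContMDiffWithinAt 𝓘(ℝ, ℝ) 𝓘(ℝ, EuclideanSpace ℝ (Fin (n + 1))) ∞
        (fun τ ↦ extChartAt (𝓡 (n + 1)) (γ t) (γ τ)) (Icc a b) t :=
      (contMDiffAt_extChartAt (I := 𝓡 (n + 1)) (x := γ t)).comp_contMDiffWithinAt t (h.1 t ht)
    exact (h1.contDiffWithinAt.of_le (by simp)).exists_lipschitzOnWith (convex_Icc a b)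
  · rw [← restrict_Ioo_eq_restrict_Icc, ae_restrict_iff' measurableSet_Ioo]
    refine Eventually.of_forall fun t ht ↦ ?_
    have hn : Icc a b ∈ 𝓝 t := Icc_mem_nhds ht.1 ht.2
    have htI := Ioo_subset_Icc_self ht
    refine ⟨((h.1 t htI).mdifferentiableWithinAt (by simp)).mdifferentiableAt hn, ?_⟩
    have := (h.2 t htI).isFutureCausal
    rwa [mfderivWithin_of_mem_nhds hn] at this

end IsSmoothFutureTimelikeCurveOn

/-- Chronologically related points are joined by a causal curve all of whose further points lie in
the chronological future of the first one. -/
theorem ChronologicallyPrecedes.exists_curve {x y : M} (h : ChronologicallyPrecedes T x y) :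
    ∃ (a b : ℝ) (γ : ℝ → M), a < b ∧ γ a = x ∧ γ b = y ∧ IsFutureCausalCurveOn T γ (Icc a b) ∧
      ∀ t ∈ Icc a b, x = γ t ∨ ChronologicallyPrecedes T x (γ t) := by
  induction h with
  | single h =>
    obtain ⟨a, b, γ, hab, rfl, rfl, hγ⟩ := h
    refine ⟨a, b, γ, hab, rfl, rfl, hγ.isFutureCausalCurveOn, fun t ht ↦ ?_⟩
    rcases ht.1.eq_or_lt with rfl | hlt
    · exact Or.inl rfl
    · exact Or.inr (hγ.chronologicallyPrecedes le_rfl hlt ht.2)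
  | tail hxy h ih =>
    obtain ⟨a, b, γ, hab, h1, h2, hγ, hall⟩ := ih
    obtain ⟨c, d, δ, hcd, rfl, rfl, hδ⟩ := h
    obtain ⟨e, ρ, hae, hρ, h3, h4, h5⟩ := IsFutureCausalCurveOn.exists_concat hab hcd hγ hδ.isFutureCausalCurveOn h2
    refine ⟨a, e, ρ, hae, h3.trans h1, h4, hρ, fun t ht ↦ ?_⟩
    rcases h5 t ht with ⟨t', ht', h⟩ | ⟨t', ht', h⟩
    · rw [h]
      exact hall t' ht'
    · rw [h]
      rcases ht'.1.eq_or_lt with rfl | hlt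
      · exact Or.inr hxy
      · exact Or.inr (hxy.trans (hδ.chronologicallyPrecedes le_rfl hlt ht'.2))

namespace IsConeChart

variable {p : M} {R K : ℝ} {f : EuclideanSpace ℝ (Fin (n + 1)) →L[ℝ] ℝ}
  {e : EuclideanSpace ℝ (Fin (n + 1))}

/-- A straight coordinate segment with timelike direction joins its end points in the
chronological order. -/
theorem chronologicallyPrecedes_of_segment (h : IsConeChart T p R K f e)
    {a b : EuclideanSpace ℝ (Fin (n + 1))}
    (ha : a ∈ Metric.ball (extChartAt (𝓡 (n + 1)) p p) R)
    (hb : b ∈ Metric.ball (extChartAt (𝓡 (n + 1)) p p) R)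
    (hab : ∀ z ∈ segment ℝ a b, chartForm g p z (b - a) (b - a) < 0) (hf : 0 < f (b - a)) :
    ChronologicallyPrecedes T ((extChartAt (𝓡 (n + 1)) p).symm a)
      ((extChartAt (𝓡 (n + 1)) p).symm b) := by
  let σ : ℝ → EuclideanSpace ℝ (Fin (n + 1)) := fun t ↦ AffineMap.lineMap a b t
  have hσs : ∀ t ∈ Icc (0 : ℝ) 1, σ t ∈ segment ℝ a b := fun t ht ↦ by
    rw [segment_eq_image_lineMap]
    exact mem_image_of_mem _ ht
  have hσB : ∀ t ∈ Icc (0 : ℝ) 1, σ t ∈ Metric.ball (extChartAt (𝓡 (n + 1)) p p) R :=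
    fun t ht ↦ (convex_ball _ R).segment_subset ha hb (hσs t ht)
  have hσd : ∀ t, HasDerivAt σ (b - a) t := fun t ↦ AffineMap.hasDerivAt_lineMap
  refine Relation.TransGen.single ⟨0, 1, fun t ↦ (extChartAt (𝓡 (n + 1)) p).symm (σ t),
    one_pos, by simp [σ], by simp [σ], ?_, fun t ht ↦ ?_⟩
  · refine (contMDiffOn_extChartAt_symm p).comp (t := (extChartAt (𝓡 (n + 1)) p).target) ?_
      (fun t ht ↦ h.ball_subset (hσB t ht))
    have : ContDiff ℝ ∞ σ := by
      simp only [σ, AffineMap.lineMap_apply_module']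
      fun_prop
    exact this.contMDiff.contMDiffOn
  · have ht' := h.ball_subset (hσB t ht)
    obtain ⟨h1, h2⟩ := mdifferentiableAt_extChartAt_symm_comp (hσd t) ht'
    rw [mfderivWithin_eq_mfderiv ((uniqueDiffOn_Icc one_pos).uniqueMDiffOn t ht) h1]
    rw [h.isFutureTimelike_iff (extChartAt_symm_mem_source ht')
      (by rw [(extChartAt (𝓡 (n + 1)) p).right_inv ht']; exact hσB t ht), h2,
      (extChartAt (𝓡 (n + 1)) p).right_inv ht']
    exact ⟨hab _ (hσs t ht), hf⟩

/-- Moving along the axis leads to the chronological future. -/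
theorem chronologicallyPrecedes_add_axis (h : IsConeChart T p R K f e)
    {a : EuclideanSpace ℝ (Fin (n + 1))} {c : ℝ} (hc : 0 < c)
    (ha : a ∈ Metric.ball (extChartAt (𝓡 (n + 1)) p p) R)
    (hb : a + c • e ∈ Metric.ball (extChartAt (𝓡 (n + 1)) p p) R) :
    ChronologicallyPrecedes T ((extChartAt (𝓡 (n + 1)) p).symm a)
      ((extChartAt (𝓡 (n + 1)) p).symm (a + c • e)) := by
  have hz : ∀ z ∈ Metric.ball (extChartAt (𝓡 (n + 1)) p p) R,
      chartForm g p z (c • e) (c • e) < 0 ∧ 0 < f (c • e) := fun z hz ↦ by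
    have := h.add_smul_axis_timelike hz (h.coneField.zero_mem hz) hc
    simpa using this
  refine h.chronologicallyPrecedes_of_segment ha hb (fun z hz' ↦ ?_) ?_
  · rw [add_sub_cancel_left]
    exact (hz z ((convex_ball _ R).segment_subset ha hb hz')).1
  · rw [add_sub_cancel_left]
    exact (hz a ha).2

/-- A cone curve gives a causal curve. -/
theorem causallyPrecedes_of_isConeCurve (h : IsConeChart T p R K f e) {r : ℝ} (hr : r < R)
    {a b : EuclideanSpace ℝ (Fin (n + 1))} {σ : ℝ → EuclideanSpace ℝ (Fin (n + 1))}
    (hσ : IsConeCurve (Metric.ball (extChartAt (𝓡 (n + 1)) p p) R)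
      (fun z ↦ formCone (chartForm g p z) f) f e K
      (Metric.closedBall (extChartAt (𝓡 (n + 1)) p p) r) a b σ) :
    CausallyPrecedes T ((extChartAt (𝓡 (n + 1)) p).symm a)
      ((extChartAt (𝓡 (n + 1)) p).symm b) := by
  have hXB : Metric.closedBall (extChartAt (𝓡 (n + 1)) p p) r ⊆
      Metric.ball (extChartAt (𝓡 (n + 1)) p p) R := Metric.closedBall_subset_ball hr
  rcases hσ.le.eq_or_lt with heq | hlt
  · left
    have h1 := hσ.right
    rw [← heq, sub_self, hσ.left] at h1
    rw [h1]
  right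
  refine ⟨0, f b - f a, fun t ↦ (extChartAt (𝓡 (n + 1)) p).symm (σ t), sub_pos.2 hlt,
    by simp only [hσ.left], by simp only [hσ.right],
    isLocallyLipschitzCurveOn_extChartAt_symm_comp hσ.lipschitzOnWith
      fun t ht ↦ h.ball_subset (hXB (hσ.mem t ht)), ?_⟩
  rw [← restrict_Ioo_eq_restrict_Icc, ae_restrict_iff' measurableSet_Ioo]
  filter_upwards [hσ.lipschitzOnWith.ae_differentiableWithinAt_of_mem] with t ht htI
  have htI' := Ioo_subset_Icc_self htI
  have hd := ((ht htI').differentiableAt (Icc_mem_nhds htI.1 htI.2)).hasDerivAt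
  obtain ⟨h1, h2⟩ := hσ.mem_of_hasDerivAt h.coneField hXB htI hd
  have ht' := h.ball_subset (hXB (hσ.mem t htI'))
  obtain ⟨h3, h4⟩ := mdifferentiableAt_extChartAt_symm_comp hd ht'
  refine ⟨h3, ?_⟩
  rw [h.isFutureCausal_iff (extChartAt_symm_mem_source ht')
    (by rw [(extChartAt (𝓡 (n + 1)) p).right_inv ht']; exact hXB (hσ.mem t htI')), h4,
    (extChartAt (𝓡 (n + 1)) p).right_inv ht', h2]
  exact ⟨h1.1, one_pos⟩

/-- A causal curve within a coordinate ball gives a cone curve. -/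
theorem exists_isConeCurve (h : IsConeChart T p R K f e) {r : ℝ} (hr : r < R) {γ : ℝ → M}
    {α β : ℝ} (hαβ : α ≤ β) (hγ : IsFutureCausalCurveOn T γ (Icc α β))
    (hsrc : ∀ t ∈ Icc α β, γ t ∈ (extChartAt (𝓡 (n + 1)) p).source)
    (hball : ∀ t ∈ Icc α β, extChartAt (𝓡 (n + 1)) p (γ t) ∈
      Metric.closedBall (extChartAt (𝓡 (n + 1)) p p) r) :
    ∃ σ, IsConeCurve (Metric.ball (extChartAt (𝓡 (n + 1)) p p) R)
      (fun z ↦ formCone (chartForm g p z) f) f e K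
      (Metric.closedBall (extChartAt (𝓡 (n + 1)) p p) r)
      (extChartAt (𝓡 (n + 1)) p (γ α)) (extChartAt (𝓡 (n + 1)) p (γ β)) σ := by
  have hXB : Metric.closedBall (extChartAt (𝓡 (n + 1)) p p) r ⊆
      Metric.ball (extChartAt (𝓡 (n + 1)) p p) R := Metric.closedBall_subset_ball hr
  refine h.coneField.exists_isConeCurve hXB (γ := fun t ↦ extChartAt (𝓡 (n + 1)) p (γ t)) hαβ
    (hγ.1.extChartAt_comp subset_rfl hsrc) hball ?_
  have h2 := hγ.2
  rw [ae_restrict_iff' measurableSet_Icc] at h2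
  filter_upwards [h2] with t ht htI
  obtain ⟨h3, h4⟩ := ht htI
  rw [h.isFutureCausal_iff (hsrc t htI) (hXB (hball t htI))] at h4
  exact ⟨_, ⟨h4.1, h4.2.le⟩, hasDerivAt_extChartAt_comp h3 (hsrc t htI)⟩

/-- The starting point of a cone curve lies in the chronological past of points arbitrarily close
to its end point. -/
theorem exists_chronologicallyPrecedes_near (h : IsConeChart T p R K f e) {r : ℝ} (hr : r < R)
    {a b : EuclideanSpace ℝ (Fin (n + 1))} {σ : ℝ → EuclideanSpace ℝ (Fin (n + 1))}
    (hσ : IsConeCurve (Metric.ball (extChartAt (𝓡 (n + 1)) p p) R)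
      (fun z ↦ formCone (chartForm g p z) f) f e K
      (Metric.closedBall (extChartAt (𝓡 (n + 1)) p p) r) a b σ)
    (hab : f a < f b) {O : Set (EuclideanSpace ℝ (Fin (n + 1)))} (hO : O ∈ 𝓝 b) :
    ∃ b' ∈ O, ChronologicallyPrecedes T ((extChartAt (𝓡 (n + 1)) p).symm a)
      ((extChartAt (𝓡 (n + 1)) p).symm b') := by
  have hK := h.coneField.nonneg
  have hℓ : 0 < f b - f a := sub_pos.2 hab
  set ℓ := f b - f a with hℓ'
  -- The pushed curve ends at b + δΛ e and stays within distance δΛ of `σ`; a small `δ` keeps the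
  -- end in `O` and the curve in the ball.
  set Λ := Real.exp ((2 * K + 1) * ℓ) - 1 with hΛ
  have hΛ0 : 0 < Λ := by
    rw [hΛ, sub_pos, Real.one_lt_exp_iff]
    positivity
  have hev : ∀ᶠ δ : ℝ in 𝓝[>] 0, b + (δ * Λ) • e ∈ O ∧ r + δ * Λ < R ∧ 0 < δ := by
    have h1 : Tendsto (fun δ : ℝ ↦ b + (δ * Λ) • e) (𝓝[>] 0) (𝓝 b) := by
      have : Continuous fun δ : ℝ ↦ b + (δ * Λ) • e := by fun_prop
      have := this.tendsto 0
      simp only [zero_mul, zero_smul, add_zero] at this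
      exact this.mono_left nhdsWithin_le_nhds
    have h2 : Tendsto (fun δ : ℝ ↦ r + δ * Λ) (𝓝[>] 0) (𝓝 r) := by
      have : Continuous fun δ : ℝ ↦ r + δ * Λ := by fun_prop
      have := this.tendsto 0
      simp only [zero_mul, add_zero] at this
      exact this.mono_left nhdsWithin_le_nhds
    filter_upwards [h1 hO, h2.eventually_lt_const hr, self_mem_nhdsWithin] with δ h1 h2 h3
    exact ⟨h1, h2, h3⟩
  obtain ⟨δ, hδO, hδR, hδ⟩ := hev.exists
  let σ' : ℝ → EuclideanSpace ℝ (Fin (n + 1)) :=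
    fun s ↦ σ s + (δ * (Real.exp ((2 * K + 1) * s) - 1)) • e
  have hσ'B : ∀ s ∈ Icc 0 ℓ, σ' s ∈ Metric.ball (extChartAt (𝓡 (n + 1)) p p) R := by
    intro s hs
    have h1 := hσ.mem s hs
    rw [Metric.mem_closedBall, dist_eq_norm] at h1
    rw [Metric.mem_ball, dist_eq_norm]
    have h2 : 0 ≤ Real.exp ((2 * K + 1) * s) - 1 := by
      rw [sub_nonneg]
      exact Real.one_le_exp (mul_nonneg (by positivity) hs.1)
    have h3 : Real.exp ((2 * K + 1) * s) - 1 ≤ Λ := by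
      have := Real.exp_le_exp.2 (mul_le_mul_of_nonneg_left hs.2
        (by positivity : (0 : ℝ) ≤ 2 * K + 1))
      linarith
    have h4 : ‖(δ * (Real.exp ((2 * K + 1) * s) - 1)) • e‖ ≤ δ * Λ := by
      rw [norm_smul, h.coneField.norm_axis, mul_one, Real.norm_of_nonneg (by positivity)]
      gcongr
    have h5 : σ' s - extChartAt (𝓡 (n + 1)) p p = (σ s - extChartAt (𝓡 (n + 1)) p p) +
        (δ * (Real.exp ((2 * K + 1) * s) - 1)) • e := by
      simp only [σ']
      abel
    rw [h5]
    exact (norm_add_le _ _).trans_lt (by linarith)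
  -- A mesh fine enough for both smallness conditions of `IsConeCurve.chord_mem`; finitely many
  -- timelike segments then cover the parameter interval.
  set η := min (δ / 2) (1 / (2 * K + 1)) with hη
  have hη0 : 0 < η := by positivity
  have hη1 : 2 * η ≤ δ := by
    have := min_le_left (δ / 2) (1 / (2 * K + 1))
    linarith
  have hη2 : 2 * K * η ≤ 1 := by
    have h1 := min_le_right (δ / 2) (1 / (2 * K + 1))
    rw [← hη, le_div_iff₀ (by positivity)] at h1
    nlinarith
  have hshort : ∀ s s', 0 ≤ s → s < s' → s' ≤ ℓ → s' - s ≤ η →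
      ChronologicallyPrecedes T ((extChartAt (𝓡 (n + 1)) p).symm (σ' s))
        ((extChartAt (𝓡 (n + 1)) p).symm (σ' s')) := by
    intro s s' h0 hss h1 hle
    have hB := hσ'B s ⟨h0, hss.le.trans h1⟩
    have hB' := hσ'B s' ⟨h0.trans hss.le, h1⟩
    have key : ∀ z ∈ segment ℝ (σ' s) (σ' s'),
        chartForm g p z (σ' s' - σ' s) (σ' s' - σ' s) < 0 ∧ 0 < f (σ' s' - σ' s) := by
      intro z hz
      have hzB := (convex_ball _ R).segment_subset hB hB' hz
      obtain ⟨c, hc, hmem⟩ := hσ.chord_mem h.coneField hδ h0 hss h1 (by linarith)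
        (by nlinarith) hzB hz
      have := h.add_smul_axis_timelike hzB hmem hc
      rwa [sub_add_cancel] at this
    exact h.chronologicallyPrecedes_of_segment hB hB' (fun z hz ↦ (key z hz).1)
      (key _ (left_mem_segment ℝ _ _)).2
  have hlong : ∀ k : ℕ, ∀ s s', 0 ≤ s → s < s' → s' ≤ ℓ → s' - s ≤ (k + 1) * η →
      ChronologicallyPrecedes T ((extChartAt (𝓡 (n + 1)) p).symm (σ' s))
        ((extChartAt (𝓡 (n + 1)) p).symm (σ' s')) := by
    intro k
    induction k with
    | zero =>
      intro s s' h0 hss h1 hle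
      exact hshort s s' h0 hss h1 (by simpa using hle)
    | succ k ih =>
      intro s s' h0 hss h1 hle
      by_cases hcase : s' - s ≤ η
      · exact hshort s s' h0 hss h1 hcase
      · push Not at hcase
        push_cast at hle
        exact (hshort s (s + η) h0 (by linarith) (by linarith) (by linarith)).trans
          (ih (s + η) s' (by linarith) (by linarith) h1 (by linarith))
  obtain ⟨k, hk⟩ := exists_nat_gt (ℓ / η)
  rw [div_lt_iff₀ hη0] at hk
  have := hlong k 0 ℓ le_rfl hℓ le_rfl (by linarith)
  refine ⟨σ' ℓ, ?_, ?_⟩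
  · have : σ' ℓ = b + (δ * Λ) • e := by
      simp only [σ']
      rw [hℓ', hσ.right]
    rwa [this]
  · have h0 : σ' 0 = a := by simp [σ', hσ.left]
    rwa [h0] at this

end IsConeChart

/-- Chronological pasts are open. -/
theorem isOpen_chronologicalPast (T : TimeOrientation g) (w : M) :
    IsOpen {x | ChronologicallyPrecedes T x w} := by
  rw [isOpen_iff_mem_nhds]
  intro x hx
  -- Only the beginning of the first smooth piece matters: it is replaced by a straight coordinate
  -- segment issuing from a nearby point.
  obtain ⟨x', ⟨a, b, γ, hab, rfl, rfl, hγ⟩, hx'⟩ := Relation.TransGen.head'_iff.1 hx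
  obtain ⟨R, K, f, e, h⟩ := exists_isConeChart T (γ a)
  set p := γ a with hp
  set φ := extChartAt (𝓡 (n + 1)) p with hφ
  have hpB : φ p ∈ Metric.ball (φ p) R := Metric.mem_ball_self h.pos
  have hps : p ∈ φ.source := mem_extChartAt_source p
  have haI : a ∈ Icc a b := ⟨le_rfl, hab.le⟩
  set v := chartDeriv p (γ a) (mfderivWithin 𝓘(ℝ, ℝ) (𝓡 (n + 1)) γ (Icc a b) a (1 : ℝ)) with hv
  have hd : HasDerivWithinAt (fun τ ↦ φ (γ τ)) v (Icc a b) a :=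
    hasDerivWithinAt_extChartAt_comp ((hγ.1 a haI).mdifferentiableWithinAt (by simp)) hps
  obtain ⟨hv1, hv2⟩ := (h.isFutureTimelike_iff hps hpB).1 (hγ.2 a haI)
  have hopen : ∀ᶠ q : EuclideanSpace ℝ (Fin (n + 1)) × EuclideanSpace ℝ (Fin (n + 1)) in
      𝓝 (φ p, v), q.1 ∈ Metric.ball (φ p) R ∧ chartForm g p q.1 q.2 q.2 < 0 ∧ 0 < f q.2 := by
    have hc : ContinuousAt (chartForm g p) (φ p) :=
      h.continuousOn.continuousAt (Metric.ball_mem_nhds _ h.pos)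
    have hc1 : ContinuousAt (fun q : EuclideanSpace ℝ (Fin (n + 1)) ×
        EuclideanSpace ℝ (Fin (n + 1)) ↦ chartForm g p q.1) (φ p, v) :=
      ContinuousAt.comp (x := (φ p, v)) (g := chartForm g p) (f := Prod.fst) hc continuousAt_fst
    have hc2 := (hc1.clm_apply continuousAt_snd).clm_apply continuousAt_snd
    have hc3 : ContinuousAt (fun q : EuclideanSpace ℝ (Fin (n + 1)) ×
        EuclideanSpace ℝ (Fin (n + 1)) ↦ f q.2) (φ p, v) := by fun_prop
    have hc4 : ∀ᶠ q : EuclideanSpace ℝ (Fin (n + 1)) × EuclideanSpace ℝ (Fin (n + 1)) in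
        𝓝 (φ p, v), q.1 ∈ Metric.ball (φ p) R :=
      continuousAt_fst (Metric.ball_mem_nhds _ h.pos)
    filter_upwards [hc4, hc2.eventually_lt continuousAt_const hv1,
      continuousAt_const.eventually_lt hc3 hv2] with q h1 h2 h3
    exact ⟨h1, h2, h3⟩
  obtain ⟨ρ, hρ, hP⟩ := Metric.eventually_nhds_iff_ball.1 hopen
  have hP' : ∀ z ∈ Metric.ball (φ p) ρ, ∀ u ∈ Metric.ball v ρ,
      z ∈ Metric.ball (φ p) R ∧ chartForm g p z u u < 0 ∧ 0 < f u := fun z hz u hu ↦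
    hP (z, u) (by rw [← ball_prod_same]; exact ⟨hz, hu⟩)
  -- The difference quotient at `τ` is close to the timelike velocity at `a`, so the chord to `γ τ`
  -- remains timelike when its starting point is perturbed.
  obtain ⟨τ, hτ1, hτ2, hτ3⟩ : ∃ τ ∈ Ioo a b, γ τ ∈ φ.source ∧ φ (γ τ) ∈ Metric.ball (φ p) ρ ∧
      (τ - a)⁻¹ • (φ (γ τ) - φ p) ∈ Metric.ball v ρ := by
    have h1 : Tendsto (fun τ ↦ (τ - a)⁻¹ • (φ (γ τ) - φ p)) (𝓝[Ioo a b] a) (𝓝 v) := by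
      have := hasDerivWithinAt_iff_tendsto_slope.1 hd
      refine (this.mono_left (nhdsWithin_mono _ ?_)).congr fun τ ↦ ?_
      · intro τ hτ
        exact ⟨Ioo_subset_Icc_self hτ, ne_of_gt hτ.1⟩
      · simp only [slope, vsub_eq_sub, hp]
    have h2 : Tendsto (fun τ ↦ φ (γ τ)) (𝓝[Ioo a b] a) (𝓝 (φ p)) :=
      hd.continuousWithinAt.mono Ioo_subset_Icc_self
    have h3 : Tendsto γ (𝓝[Ioo a b] a) (𝓝 p) :=
      (hγ.1.continuousOn a haI).mono Ioo_subset_Icc_self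
    have : NeBot (𝓝[Ioo a b] a) := by
      rw [nhdsWithin_Ioo_eq_nhdsGT hab]
      infer_instance
    obtain ⟨τ, k1, k2, k3, k4⟩ := ((eventually_mem_nhdsWithin (a := a) (s := Ioo a b)).and
      ((h3.eventually ((isOpen_extChartAt_source p).mem_nhds hps)).and
      ((h2.eventually (Metric.ball_mem_nhds _ hρ)).and (h1.eventually (Metric.ball_mem_nhds _ hρ))))).exists
    exact ⟨τ, k1, k2, k3, k4⟩
  obtain ⟨hτ3, hτ4⟩ := hτ3
  have hτa : 0 < τ - a := sub_pos.2 hτ1.1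
  have hBρ : Metric.ball (φ p) ρ ⊆ Metric.ball (φ p) R := fun z hz ↦
    (hP' z hz v (Metric.mem_ball_self hρ)).1
  have hcont : ContinuousAt φ p := continuousAt_extChartAt p
  have hτw : ChronologicallyPrecedes T (γ τ) w := by
    have h1 := hγ.chronologicallyPrecedes hτ1.1.le hτ1.2 le_rfl
    rcases Relation.reflTransGen_iff_eq_or_transGen.1 hx' with h2 | h2
    · rw [h2]; exact h1
    · exact h1.trans h2
  have hcone : ∀ᶠ y in 𝓝 p, ∀ z ∈ Metric.ball (φ p) ρ,
      chartForm g p z (φ (γ τ) - φ y) (φ (γ τ) - φ y) < 0 ∧ 0 < f (φ (γ τ) - φ y) := by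
    have h1 : ContinuousAt (fun y ↦ (τ - a)⁻¹ • (φ (γ τ) - φ y)) p :=
      Tendsto.const_smul (Tendsto.sub tendsto_const_nhds hcont) _
    filter_upwards [h1 (Metric.isOpen_ball.mem_nhds hτ4)] with y hy z hz
    obtain ⟨-, h2, h3⟩ := hP' z hz _ hy
    simp only [map_smul, smul_apply, smul_eq_mul] at h2 h3
    have h4 : 0 < (τ - a)⁻¹ := inv_pos.2 hτa
    exact ⟨by
      by_contra! hcon
      have := mul_nonneg h4.le (mul_nonneg h4.le hcon)
      linarith, (mul_pos_iff_of_pos_left h4).1 h3⟩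
  filter_upwards [hcone, hcont (Metric.ball_mem_nhds _ hρ),
    (isOpen_extChartAt_source p).mem_nhds hps] with y hy1 hy2 hy3
  have h1 := h.chronologicallyPrecedes_of_segment (hBρ hy2) (hBρ hτ3)
    (fun z hz ↦ (hy1 z ((convex_ball _ ρ).segment_subset hy2 hτ3 hz)).1) (hy1 _ hy2).2
  rw [φ.left_inv hy3, φ.left_inv hτ2] at h1
  exact h1.trans hτw

end LocalCausality

/-! ### Construction of inextendible curves -/

section Inextendible

variable {n : ℕ} {M : Type*} [TopologicalSpace M]
  [ChartedSpace (EuclideanSpace ℝ (Fin (n + 1))) M] [IsManifold (𝓡 (n + 1)) ∞ M]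

omit [IsManifold (𝓡 (n + 1)) ∞ M] in
theorem HasVelocityInOn.of_forall_nat {P : ∀ x : M, TangentSpace (𝓡 (n + 1)) x → Prop}
    {γ : ℝ → M} (h : ∀ k : ℕ, HasVelocityInOn P γ (Icc (k : ℝ) (k + 1))) :
    HasVelocityInOn P γ (Ici 0) := by
  have hN : ∀ N : ℕ, HasVelocityInOn P γ (Icc 0 ((N : ℝ) + 1)) := by
    intro N
    induction N with
    | zero => simpa using h 0
    | succ N ih =>
      have := h (N + 1)
      push_cast at this ⊢
      exact ih.union this (by positivity) (by linarith)
  have hmem : ∀ t ∈ Ici (0 : ℝ), ∃ N : ℕ, t ∈ Icc (0 : ℝ) (N + 1) ∧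
      𝓝[Ici 0] t ≤ 𝓝[Icc (0 : ℝ) (N + 1)] t := by
    intro t ht
    obtain ⟨N, hN⟩ := exists_nat_gt t
    refine ⟨N, ⟨ht, by linarith⟩, nhdsWithin_le_of_mem ?_⟩
    filter_upwards [self_mem_nhdsWithin, nhdsWithin_le_nhds (Iio_mem_nhds hN)] with τ h1 h2
    exact ⟨h1, by linarith [mem_Iio.1 h2]⟩
  refine ⟨⟨fun t ht ↦ ?_, fun t ht ↦ ?_⟩, ?_⟩
  · obtain ⟨N, h1, h2⟩ := hmem t ht
    exact ((hN N).1.1 t h1).mono_left h2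
  · obtain ⟨N, h1, h2⟩ := hmem t ht
    obtain ⟨L, u, hu, hL⟩ := (hN N).1.2 t h1
    exact ⟨L, u, h2 hu, hL⟩
  · have hU : Ici (0 : ℝ) = ⋃ N : ℕ, Icc (0 : ℝ) (N + 1) := by
      ext t
      simp only [mem_iUnion]
      refine ⟨fun ht ↦ ?_, fun ⟨N, hN⟩ ↦ hN.1⟩
      obtain ⟨N, h1, -⟩ := hmem t ht
      exact ⟨N, h1⟩
    rw [hU, ae_restrict_iUnion_iff]
    exact fun N ↦ (hN N).2

omit [IsManifold (𝓡 (n + 1)) ∞ M] in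
/-- If every point has a neighbourhood that can be left by a curve within `W` from each of its
points in `W`, then there is an inextendible curve within `W` from each point of `W`. -/
theorem exists_inextendible_of_exists_exit [SecondCountableTopology M]
    {P : ∀ x : M, TangentSpace (𝓡 (n + 1)) x → Prop} {W : Set M}
    (hstep : ∀ p : M, ∃ V : Set M, IsOpen V ∧ p ∈ V ∧ ∀ w ∈ W, w ∈ V → ∃ w' ∈ W, w' ∉ V ∧
      ∃ γ : ℝ → M, γ 0 = w ∧ γ 1 = w' ∧ HasVelocityInOn P γ (Icc 0 1) ∧
        ∀ t ∈ Icc (0 : ℝ) 1, γ t ∈ W) {w : M} (hw : w ∈ W) :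
    ∃ γ : ℝ → M, γ 0 = w ∧ HasVelocityInOn P γ (Ici 0) ∧ (¬ ∃ y, Tendsto γ atTop (𝓝 y)) ∧
      ∀ t, 0 ≤ t → γ t ∈ W := by
  choose V hVo hpV hV using hstep
  choose! nxt hnW hnV crv hc0 hc1 hcP hcW using hV
  obtain ⟨s, hs, hcov⟩ := TopologicalSpace.countable_cover_nhds
    (fun p ↦ (hVo p).mem_nhds (hpV p))
  have hsne : s.Nonempty := by
    have : w ∈ ⋃ x ∈ s, V x := by rw [hcov]; exact mem_univ w
    obtain ⟨x, hx, -⟩ := mem_iUnion₂.1 this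
    exact ⟨x, hx⟩
  obtain ⟨q, rfl⟩ := hs.exists_eq_range hsne
  have hcov' : ∀ x, ∃ i, x ∈ V (q i) := fun x ↦ by
    have : x ∈ ⋃ y ∈ range q, V y := by rw [hcov]; exact mem_univ x
    simpa using this
  -- Every member of the countable cover is listed infinitely often, so it can be left again at
  -- arbitrarily late stages.
  let c : ℕ → M := fun m ↦ q m.unpair.1
  have hc : ∀ i m, ∃ j, m ≤ j ∧ c j = q i := fun i m ↦
    ⟨Nat.pair i m, Nat.right_le_pair i m, by simp [c]⟩
  have hlev : ∀ (x : M) (m : ℕ), ∃ j, (m ≤ j ∧ x ∈ V (c j)) ∧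
      ∀ k, m ≤ k → x ∈ V (c k) → j ≤ k := by
    classical
    intro x m
    have hex : ∃ j, m ≤ j ∧ x ∈ V (c j) := by
      obtain ⟨i, hi⟩ := hcov' x
      obtain ⟨j, h1, h2⟩ := hc i m
      exact ⟨j, h1, by rwa [h2]⟩
    exact ⟨Nat.find hex, Nat.find_spec hex, fun k h1 h2 ↦ Nat.find_min' hex ⟨h1, h2⟩⟩
  choose lev hlev1 hlev2 using hlev
  -- The state is the current point and the first index still available. Each step leaves the first
  -- listed neighbourhood, from that index on, which contains the point.
  let st : ℕ → M × ℕ := fun k ↦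
    Nat.rec (w, 0) (fun _ s ↦ (nxt (c (lev s.1 s.2)) s.1, lev s.1 s.2 + 1)) k
  let x : ℕ → M := fun k ↦ (st k).1
  let l : ℕ → ℕ := fun k ↦ lev (st k).1 (st k).2
  have hx0 : x 0 = w := rfl
  have hxs : ∀ k, x (k + 1) = nxt (c (l k)) (x k) := fun k ↦ rfl
  have hls : ∀ k, (st (k + 1)).2 = l k + 1 := fun k ↦ rfl
  have hxW : ∀ k, x k ∈ W := by
    intro k
    induction k with
    | zero => exact hw
    | succ k ih => exact hnW _ _ ih (hlev1 _ _).2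
  have hxV : ∀ k, x k ∈ V (c (l k)) := fun k ↦ (hlev1 _ _).2
  let δ : ℕ → ℝ → M := fun k t ↦ crv (c (l k)) (x k) t
  have hδ0 : ∀ k, δ k 0 = x k := fun k ↦ hc0 _ _ (hxW k) (hxV k)
  have hδ1 : ∀ k, δ k 1 = x (k + 1) := fun k ↦ hc1 _ _ (hxW k) (hxV k)
  let γ : ℝ → M := fun t ↦ δ ⌊t⌋₊ (t - ⌊t⌋₊)
  have hγk : ∀ k : ℕ, γ k = x k := fun k ↦ by simp [γ, hδ0]
  have hγ : ∀ k : ℕ, EqOn γ (fun t ↦ δ k (1 * t + -k)) (Icc (k : ℝ) (k + 1)) := by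
    intro k t ht
    rcases ht.2.eq_or_lt with rfl | hlt
    · have := hγk (k + 1)
      push_cast at this
      simp only [this, ← hδ1]
      congr 1
      ring
    · have : ⌊t⌋₊ = k := (Nat.floor_eq_iff (k.cast_nonneg.trans ht.1)).2 ⟨ht.1, hlt⟩
      simp only [γ, this]
      congr 1
      ring
  have hpre : ∀ k : ℕ, ∀ t ∈ Icc (k : ℝ) (k + 1), 1 * t + -(k : ℝ) ∈ Icc (0 : ℝ) 1 :=
    fun k t ht ↦ ⟨by linarith [ht.1], by linarith [ht.2]⟩
  refine ⟨γ, ?_, HasVelocityInOn.of_forall_nat fun k ↦ ?_, ?_, ?_⟩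
  · have := hγk 0
    rwa [Nat.cast_zero] at this
  · refine HasVelocityInOn.congr ?_ (hγ k)
    refine (HasVelocityInOn.comp_affine (Q := P) (hcP _ _ (hxW k) (hxV k)) measurableSet_Icc
      one_ne_zero (-k) fun x v hv ↦ ?_).mono (hpre k)
    rwa [one_smul]
  · rintro ⟨y, hy⟩
    obtain ⟨i, hi⟩ := hcov' y
    have h1 : ∀ᶠ k : ℕ in atTop, x k ∈ V (q i) := by
      have := (hy.comp tendsto_natCast_atTop_atTop).eventually ((hVo (q i)).mem_nhds hi)
      filter_upwards [this] with k hk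
      rwa [Function.comp_apply, hγk] at hk
    obtain ⟨N, hN⟩ := eventually_atTop.1 h1
    obtain ⟨m, hm1, hm2⟩ := hc i (st N).2
    -- While the vertices stay in `V (q i)`, the index cannot pass `m`, as `c m = q i` is a
    -- candidate, and choosing `m` would make the next vertex leave. But the index grows at every
    -- step.
    have h2 : ∀ k, (st (N + k)).2 ≤ m := by
      intro k
      induction k with
      | zero => exact hm1
      | succ k ih =>
        have h3 : l (N + k) ≤ m := hlev2 _ _ m ih (by rw [hm2]; exact hN (N + k) (by omega))
        rcases h3.eq_or_lt with h4 | h4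
        · exfalso
          have h5 := hnV _ _ (hxW (N + k)) (hxV (N + k))
          rw [← hxs, h4, hm2] at h5
          exact h5 (hN (N + k + 1) (by omega))
        · rw [← add_assoc, hls]
          omega
    have h6 : ∀ k, k ≤ (st k).2 := by
      intro k
      induction k with
      | zero => exact Nat.zero_le _
      | succ k ih =>
        rw [hls]
        have : (st k).2 ≤ l k := (hlev1 _ _).1
        omega
    have := (h6 (N + (m + 1))).trans (h2 (m + 1))
    omega
  · intro t ht
    have htI : t ∈ Icc (⌊t⌋₊ : ℝ) (⌊t⌋₊ + 1) := ⟨Nat.floor_le ht, (Nat.lt_floor_add_one t).le⟩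
    rw [hγ _ htI]
    exact hcW _ _ (hxW _) (hxV _) _ (hpre _ t htI)

end Inextendible

/-! ### Push-up, limits of causal relations and the Cauchy surface -/

section Global

variable {n : ℕ} {M : Type*} [TopologicalSpace M]
  [ChartedSpace (EuclideanSpace ℝ (Fin (n + 1))) M] [IsManifold (𝓡 (n + 1)) ∞ M]
  {g : LorentzianMetric n M} {T : TimeOrientation g}

omit [IsManifold (𝓡 (n + 1)) ∞ M] in
theorem exists_chart_nhds {p : M} {r : ℝ} (hr : 0 < r) :
    IsOpen ((extChartAt (𝓡 (n + 1)) p).source ∩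
      extChartAt (𝓡 (n + 1)) p ⁻¹' Metric.ball (extChartAt (𝓡 (n + 1)) p p) r) ∧
    p ∈ (extChartAt (𝓡 (n + 1)) p).source ∩
      extChartAt (𝓡 (n + 1)) p ⁻¹' Metric.ball (extChartAt (𝓡 (n + 1)) p p) r :=
  ⟨(continuousOn_extChartAt p).isOpen_inter_preimage (isOpen_extChartAt_source p)
    Metric.isOpen_ball, mem_extChartAt_source p, Metric.mem_ball_self hr⟩

namespace IsConeChart

variable {p : M} {R K : ℝ} {f : EuclideanSpace ℝ (Fin (n + 1)) →L[ℝ] ℝ}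
  {e : EuclideanSpace ℝ (Fin (n + 1))}

/-- Being closed in the whole manifold, not just in the chart domain, is what the Hausdorff property
provides: the set is a continuous image of a compact ball. -/
theorem isClosed_closedBall [T2Space M] (h : IsConeChart T p R K f e) {r : ℝ} (hr : r < R) :
    IsClosed ((extChartAt (𝓡 (n + 1)) p).source ∩
      extChartAt (𝓡 (n + 1)) p ⁻¹' Metric.closedBall (extChartAt (𝓡 (n + 1)) p p) r) := by
  have hsub : Metric.closedBall (extChartAt (𝓡 (n + 1)) p p) r ⊆
      (extChartAt (𝓡 (n + 1)) p).target :=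
    (Metric.closedBall_subset_ball hr).trans h.ball_subset
  rw [← (extChartAt (𝓡 (n + 1)) p).symm_image_eq_source_inter_preimage hsub]
  exact ((isCompact_closedBall _ r).image_of_continuousOn
    ((continuousOn_extChartAt_symm p).mono hsub)).isClosed

/-- The local form of push-up: a small shift of the end point makes the curve timelike, and openness
of the chronological past of `w` absorbs the shift. -/
theorem chronologicallyPrecedes_of_isConeCurve (h : IsConeChart T p R K f e) {r : ℝ} (hr : r < R)
    {a b : EuclideanSpace ℝ (Fin (n + 1))} {σ : ℝ → EuclideanSpace ℝ (Fin (n + 1))}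
    (hσ : IsConeCurve (Metric.ball (extChartAt (𝓡 (n + 1)) p p) R)
      (fun z ↦ formCone (chartForm g p z) f) f e K
      (Metric.closedBall (extChartAt (𝓡 (n + 1)) p p) r) a b σ) {w : M}
    (hw : ChronologicallyPrecedes T ((extChartAt (𝓡 (n + 1)) p).symm b) w) :
    ChronologicallyPrecedes T ((extChartAt (𝓡 (n + 1)) p).symm a) w := by
  rcases hσ.le.eq_or_lt with heq | hlt
  · have h1 := hσ.right
    rw [← heq, sub_self, hσ.left] at h1
    rwa [h1]
  · have hb : b ∈ (extChartAt (𝓡 (n + 1)) p).target := by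
      have := hσ.mem (f b - f a) ⟨sub_nonneg.2 hσ.le, le_rfl⟩
      rw [hσ.right] at this
      exact h.ball_subset (Metric.closedBall_subset_ball hr this)
    have hO : (extChartAt (𝓡 (n + 1)) p).symm ⁻¹' {x | ChronologicallyPrecedes T x w} ∈ 𝓝 b :=
      (continuousAt_extChartAt_symm'' hb) ((isOpen_chronologicalPast T w).mem_nhds hw)
    obtain ⟨b', hb', h1⟩ := h.exists_chronologicallyPrecedes_near hr hσ hlt hO
    exact h1.trans hb'

end IsConeChart

/-- The push-up property: `x ≤ y ≪ z` implies `x ≪ z`. -/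
theorem CausallyPrecedes.trans_chronologicallyPrecedes {x y z : M} (hxy : CausallyPrecedes T x y)
    (hyz : ChronologicallyPrecedes T y z) : ChronologicallyPrecedes T x z := by
  rcases hxy with rfl | ⟨α, β, γ, hαβ, rfl, rfl, hγ⟩
  · exact hyz
  by_contra hcon
  set A := Icc α β ∩ γ ⁻¹' {x | ChronologicallyPrecedes T x z}ᶜ with hA
  have hAc : IsCompact A :=
    isCompact_Icc.of_isClosed_subset (hγ.1.1.preimage_isClosed_of_isClosed isClosed_Icc
      (isOpen_chronologicalPast T z).isClosed_compl) inter_subset_left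
  -- The last parameter outside the chronological past of `z`. Points just after it lie inside, and
  -- local push-up brings it inside as well.
  obtain ⟨t₀, ⟨ht₀I, ht₀⟩, ht₀max⟩ := hAc.exists_isGreatest ⟨α, ⟨le_rfl, hαβ.le⟩, hcon⟩
  have hlt : t₀ < β := by
    refine lt_of_le_of_ne ht₀I.2 ?_
    rintro rfl
    exact ht₀ hyz
  obtain ⟨R, K, f, e, h⟩ := exists_isConeChart T (γ t₀)
  have hR := h.pos
  obtain ⟨ho, hm⟩ := exists_chart_nhds (n := n) (p := γ t₀) (half_pos hR)
  obtain ⟨ε, hε, hεs⟩ := Metric.mem_nhdsWithin_iff.1 (hγ.1.1 t₀ ht₀I (ho.mem_nhds hm))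
  set t₁ := min (t₀ + ε / 2) β with ht₁
  have h01 : t₀ < t₁ := lt_min (by linarith) hlt
  have h1β : t₁ ≤ β := min_le_right _ _
  have hin : ∀ t ∈ Icc t₀ t₁, γ t ∈ (extChartAt (𝓡 (n + 1)) (γ t₀)).source ∩
      extChartAt (𝓡 (n + 1)) (γ t₀) ⁻¹'
        Metric.ball (extChartAt (𝓡 (n + 1)) (γ t₀) (γ t₀)) (R / 2) := by
    intro t ht
    refine hεs ⟨?_, ht₀I.1.trans ht.1, ht.2.trans h1β⟩
    rw [Metric.mem_ball, Real.dist_eq, abs_of_nonneg (sub_nonneg.2 ht.1)]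
    have := min_le_left (t₀ + ε / 2) β
    linarith [ht.2]
  obtain ⟨σ, hσ⟩ := h.exists_isConeCurve (half_lt_self hR) h01.le
    (HasVelocityInOn.mono (P := IsFutureCausal T) hγ (Icc_subset_Icc ht₀I.1 h1β))
    (fun t ht ↦ (hin t ht).1) (fun t ht ↦ Metric.ball_subset_closedBall (hin t ht).2)
  have hgood : ChronologicallyPrecedes T (γ t₁) z := by
    by_contra hbad
    exact absurd (ht₀max ⟨⟨ht₀I.1.trans h01.le, h1β⟩, hbad⟩) (not_le.2 h01)
  refine ht₀ ?_
  have := h.chronologicallyPrecedes_of_isConeCurve (half_lt_self hR) hσ (w := z) (by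
    rwa [(extChartAt (𝓡 (n + 1)) (γ t₀)).left_inv (hin t₁ ⟨h01.le, le_rfl⟩).1])
  rwa [(extChartAt (𝓡 (n + 1)) (γ t₀)).left_inv (hin t₀ ⟨le_rfl, h01.le⟩).1] at this

/-- A causal predecessor of a point in a coordinate ball is reached either within the ball or through
its boundary. -/
theorem IsConeChart.exists_isConeCurve_or_exit [T2Space M] {p : M} {R K : ℝ}
    {f : EuclideanSpace ℝ (Fin (n + 1)) →L[ℝ] ℝ} {e : EuclideanSpace ℝ (Fin (n + 1))}
    (h : IsConeChart T p R K f e) {r : ℝ} (hr : r < R) {x y : M} (hxy : CausallyPrecedes T x y)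
    (hy : y ∈ (extChartAt (𝓡 (n + 1)) p).source ∩
      extChartAt (𝓡 (n + 1)) p ⁻¹' Metric.ball (extChartAt (𝓡 (n + 1)) p p) r) :
    ∃ c, (c = x ∨ CausallyPrecedes T x c ∧
        extChartAt (𝓡 (n + 1)) p c ∉ Metric.ball (extChartAt (𝓡 (n + 1)) p p) r) ∧
      c ∈ (extChartAt (𝓡 (n + 1)) p).source ∧
      ∃ σ, IsConeCurve (Metric.ball (extChartAt (𝓡 (n + 1)) p p) R)
        (fun z ↦ formCone (chartForm g p z) f) f e K
        (Metric.closedBall (extChartAt (𝓡 (n + 1)) p p) r)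
        (extChartAt (𝓡 (n + 1)) p c) (extChartAt (𝓡 (n + 1)) p y) σ := by
  set φ := extChartAt (𝓡 (n + 1)) p with hφ
  rcases hxy with rfl | ⟨α, β, γ, hαβ, rfl, rfl, hγ⟩
  · refine ⟨x, Or.inl rfl, hy.1, fun _ ↦ φ x, le_rfl, rfl, rfl,
      fun s hs ↦ Metric.ball_subset_closedBall hy.2, ?_, ?_, ?_⟩
    · intro s hs
      rw [sub_self] at hs
      rw [le_antisymm hs.2 hs.1, add_zero]
    · intro s s' h0 hss h1
      simpa using hss
    · intro s s' h0 hss h1 z hz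
      have : s' = s := by linarith
      rw [this]
      simpa using h.coneField.zero_mem hz
  have hr0 : 0 < r := (dist_nonneg).trans_lt (Metric.mem_ball.1 hy.2)
  obtain ⟨ho, -⟩ := exists_chart_nhds (n := n) (p := p) hr0
  set V := φ.source ∩ φ ⁻¹' Metric.ball (φ p) r with hV
  by_cases hall : ∀ t ∈ Icc α β, γ t ∈ V
  · exact ⟨γ α, Or.inl rfl, (hall α ⟨le_rfl, hαβ.le⟩).1,
      h.exists_isConeCurve hr hαβ.le hγ (fun t ht ↦ (hall t ht).1)
        fun t ht ↦ Metric.ball_subset_closedBall (hall t ht).2⟩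
  push Not at hall
  obtain ⟨t, htI, htV⟩ := hall
  set A := Icc α β ∩ γ ⁻¹' Vᶜ with hA
  have hAc : IsCompact A :=
    isCompact_Icc.of_isClosed_subset (hγ.1.1.preimage_isClosed_of_isClosed isClosed_Icc
      ho.isClosed_compl) inter_subset_left
  -- The last parameter outside the open ball: the rest of the curve lies in the closed ball, which
  -- contains `γ t₀` because it is closed in `M`.
  obtain ⟨t₀, ⟨ht₀I, ht₀⟩, ht₀max⟩ := hAc.exists_isGreatest ⟨t, htI, htV⟩
  have hlt : t₀ < β := by
    refine lt_of_le_of_ne ht₀I.2 ?_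
    rintro rfl
    exact ht₀ hy
  have hafter : ∀ t ∈ Ioc t₀ β, γ t ∈ V := by
    intro t ht
    by_contra hbad
    exact absurd (ht₀max ⟨⟨ht₀I.1.trans ht.1.le, ht.2⟩, hbad⟩) (not_le.2 ht.1)
  have hVK : V ⊆ φ.source ∩ φ ⁻¹' Metric.closedBall (φ p) r :=
    inter_subset_inter_right _ (preimage_mono Metric.ball_subset_closedBall)
  have ht₀K : γ t₀ ∈ φ.source ∩ φ ⁻¹' Metric.closedBall (φ p) r := by
    have hne : NeBot (𝓝[Ioc t₀ β] t₀) := by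
      rw [nhdsWithin_Ioc_eq_nhdsGT hlt]
      infer_instance
    refine (h.isClosed_closedBall hr).mem_of_tendsto (b := 𝓝[Ioc t₀ β] t₀) (f := γ) ?_ ?_
    · exact (hγ.1.1 t₀ ht₀I).mono fun t ht ↦ ⟨ht₀I.1.trans ht.1.le, ht.2⟩
    · filter_upwards [self_mem_nhdsWithin] with t ht
      exact hVK (hafter t ht)
  have hall : ∀ t ∈ Icc t₀ β, γ t ∈ φ.source ∩ φ ⁻¹' Metric.closedBall (φ p) r := by
    intro t ht
    rcases ht.1.eq_or_lt with rfl | h1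
    · exact ht₀K
    · exact hVK (hafter t ⟨h1, ht.2⟩)
  refine ⟨γ t₀, Or.inr ⟨hγ.causallyPrecedes le_rfl ht₀I.1 ht₀I.2, fun hb ↦ ht₀ ⟨ht₀K.1, hb⟩⟩,
    ht₀K.1, h.exists_isConeCurve hr hlt.le
      (HasVelocityInOn.mono (P := IsFutureCausal T) hγ (Icc_subset_Icc ht₀I.1 le_rfl))
      (fun t ht ↦ (hall t ht).1) fun t ht ↦ (hall t ht).2⟩

/-- There are points of the chronological future of `c` arbitrarily close to `c`. -/
theorem exists_mem_chronologicallyPrecedes (T : TimeOrientation g) {c : M} {O : Set M}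
    (hO : O ∈ 𝓝 c) : ∃ w ∈ O, ChronologicallyPrecedes T c w := by
  obtain ⟨R, K, f, e, h⟩ := exists_isConeChart T c
  set φ := extChartAt (𝓡 (n + 1)) c with hφ
  have h1 : Tendsto (fun δ : ℝ ↦ φ c + δ • e) (𝓝[>] 0) (𝓝 (φ c)) := by
    have : Continuous fun δ : ℝ ↦ φ c + δ • e := by fun_prop
    have := this.tendsto 0
    simp only [zero_smul, add_zero] at this
    exact this.mono_left nhdsWithin_le_nhds
  have h2 : φ.symm ⁻¹' O ∈ 𝓝 (φ c) := by
    refine (continuousAt_extChartAt_symm c) ?_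
    rwa [extChartAt_to_inv]
  obtain ⟨δ, hδ1, hδ2, hδ⟩ := ((h1.eventually (Metric.ball_mem_nhds _ h.pos)).and
    ((h1.eventually h2).and self_mem_nhdsWithin)).exists
  refine ⟨φ.symm (φ c + δ • e), hδ2, ?_⟩
  have := h.chronologicallyPrecedes_add_axis hδ (Metric.mem_ball_self h.pos) hδ1
  rwa [φ.left_inv (mem_extChartAt_source c)] at this

/-- Every point starts a future inextendible causal curve all of whose further points lie in its
chronological future. -/
theorem exists_isFutureInextendibleCausalCurveFrom [SecondCountableTopology M]
    (T : TimeOrientation g) (w : M) : ∃ γ, IsFutureInextendibleCausalCurveFrom T w γ ∧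
      ∀ t, 0 ≤ t → w = γ t ∨ ChronologicallyPrecedes T w (γ t) := by
  obtain ⟨γ, h1, h2, h3, h4⟩ := exists_inextendible_of_exists_exit (P := IsFutureCausal T)
    (W := {x | w = x ∨ ChronologicallyPrecedes T w x}) (fun p ↦ by
      obtain ⟨R, K, f, e, h⟩ := exists_isConeChart T p
      have hR := h.pos
      -- A shift by R/2 along the unit axis leads out of the ball of radius R/4 but not out of the
      -- ball of radius `R`.
      obtain ⟨ho, hm⟩ := exists_chart_nhds (n := n) (p := p) (r := R / 4) (by linarith)
      set φ := extChartAt (𝓡 (n + 1)) p with hφ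
      refine ⟨_, ho, hm, fun x hx hxV ↦ ?_⟩
      have hxd := Metric.mem_ball.1 hxV.2
      rw [dist_eq_norm] at hxd
      have hen : ‖(R / 2) • e‖ = R / 2 := by
        rw [norm_smul, h.coneField.norm_axis, mul_one, Real.norm_of_nonneg (by linarith)]
      have hb : φ x + (R / 2) • e ∈ Metric.ball (φ p) R := by
        rw [Metric.mem_ball, dist_eq_norm]
        have := norm_add_le (φ x - φ p) ((R / 2) • e)
        rw [hen] at this
        have h5 : φ x + (R / 2) • e - φ p = φ x - φ p + (R / 2) • e := by abel
        rw [h5]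
        linarith
      have hxx' : ChronologicallyPrecedes T x (φ.symm (φ x + (R / 2) • e)) := by
        have := h.chronologicallyPrecedes_add_axis (half_pos hR)
          (Metric.ball_subset_ball (by linarith) hxV.2) hb
        rwa [φ.left_inv hxV.1] at this
      have hWtrans : ∀ y, ChronologicallyPrecedes T x y → ChronologicallyPrecedes T w y := by
        intro y hy
        rcases hx with rfl | hx
        · exact hy
        · exact hx.trans hy
      refine ⟨_, Or.inr (hWtrans _ hxx'), fun hmem ↦ ?_, ?_⟩
      · have := hmem.2
        rw [mem_preimage, φ.right_inv (h.ball_subset hb), Metric.mem_ball, dist_eq_norm] at this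
        have h5 := norm_sub_le (φ x + (R / 2) • e - φ p) (φ x - φ p)
        have h6 : φ x + (R / 2) • e - φ p - (φ x - φ p) = (R / 2) • e := by abel
        rw [h6, hen] at h5
        linarith
      · obtain ⟨a, b, γ, hab, ha, hb, hγ, hall⟩ := hxx'.exists_curve
        obtain ⟨δ, h1, h2, h3, h4⟩ := IsFutureCausalCurveOn.exists_reparam hab hγ one_pos
        refine ⟨δ, h2.trans ha, h3.trans hb, h1, fun t ht ↦ ?_⟩
        obtain ⟨t', ht', h5⟩ := h4 t ht
        rw [h5]
        rcases hall t' ht' with h6 | h6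
        · rw [← h6]
          exact hx
        · exact Or.inr (hWtrans _ h6)) (w := w) (Or.inl rfl)
  exact ⟨γ, ⟨h1, h2, h3⟩, h4⟩

/-- A past directed causal curve from `y` to `x ≪ y` within `{x} ∪ I⁺(x)`. -/
theorem ChronologicallyPrecedes.exists_past_curve {x y : M} (h : ChronologicallyPrecedes T x y) :
    ∃ γ : ℝ → M, γ 0 = y ∧ γ 1 = x ∧ IsPastCausalCurveOn T γ (Icc 0 1) ∧
      ∀ t ∈ Icc (0 : ℝ) 1, x = γ t ∨ ChronologicallyPrecedes T x (γ t) := by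
  obtain ⟨a, b, γ, hab, ha, hb, hγ, hall⟩ := h.exists_curve
  obtain ⟨δ, h1, h2, h3, h4⟩ := IsFutureCausalCurveOn.exists_reparam hab hγ one_pos
  have hpre : ∀ t ∈ Icc (0 : ℝ) 1, -1 * t + 1 ∈ Icc (0 : ℝ) 1 := fun t ht ↦
    ⟨by linarith [ht.2], by linarith [ht.1]⟩
  refine ⟨fun t ↦ δ (-1 * t + 1), ?_, ?_, ?_, fun t ht ↦ ?_⟩
  · simp [h3, hb]
  · simp [h2, ha]
  · exact (HasVelocityInOn.comp_affine (P := IsFutureCausal T) (Q := IsPastCausal T) h1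
      measurableSet_Icc (by norm_num) 1
      fun x v hv ↦ isPastCausal_smul_of_neg hv (by norm_num)).mono hpre
  · obtain ⟨t', ht', h5⟩ := h4 _ (hpre t ht)
    simp only [h5]
    exact hall t' ht'

/-- In the presence of a Cauchy surface, points of the future of that surface that causally precede
convergent points converge along ultrafilters, and the limit causally precedes the limit. -/
theorem IsCauchySurface.exists_tendsto_causallyPrecedes [T2Space M] [SecondCountableTopology M]
    {S : Set M} (hS : IsCauchySurface T S) {ι : Type*} {𝒰 : Ultrafilter ι} {a b : ι → M} {y : M}
    (hb : Tendsto b 𝒰 (𝓝 y)) (hab : ∀ᶠ i in 𝒰, CausallyPrecedes T (a i) (b i))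
    (ha : ∀ᶠ i in 𝒰, ∃ s ∈ S, CausallyPrecedes T s (a i)) :
    ∃ x, Tendsto a 𝒰 (𝓝 x) ∧ CausallyPrecedes T x y := by
  by_contra hcon
  have : Nonempty M := ⟨y⟩
  -- Points of `Q` play the part of points on a past directed limit curve from `y`. Passing to their
  -- chronological futures leaves room for the open relation.
  let Q : M → Prop := fun z ↦ CausallyPrecedes T z y ∧
    ∃ b : ι → M, Tendsto b 𝒰 (𝓝 z) ∧ ∀ᶠ i in 𝒰, CausallyPrecedes T (a i) (b i)
  let W : Set M := {w | ∃ z, Q z ∧ ChronologicallyPrecedes T z w}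
  -- The chronological past of `w` is a neighbourhood of `z`, so it contains some `b i`; push-up
  -- applies to s ≤ a i ≤ b i ≪ w.
  have hWS : ∀ w ∈ W, ∃ s ∈ S, ChronologicallyPrecedes T s w := by
    rintro w ⟨z, ⟨-, b, hb, hab⟩, hzw⟩
    obtain ⟨i, h1, h2, s, hs, h3⟩ := ((hb.eventually
      ((isOpen_chronologicalPast T w).mem_nhds hzw)).and (hab.and ha)).exists
    exact ⟨s, hs, (h3.trans h2).trans_chronologicallyPrecedes h1⟩
  obtain ⟨w, -, hyw⟩ := exists_mem_chronologicallyPrecedes T (c := y) univ_mem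
  have hwW : w ∈ W := ⟨y, ⟨Or.inl rfl, b, hb, hab⟩, hyw⟩
  have hw : w ∈ cauchyDevelopment T S := by
    rw [hS.cauchyDevelopment_eq]
    exact mem_univ w
  rcases hw with hw | hw
  swap
  -- In the past development, a future inextendible curve in {w} ∪ I⁺(w) would meet `S` at a point
  -- of I⁺(S).
  · obtain ⟨γ, h1, h2⟩ := exists_isFutureInextendibleCausalCurveFrom T w
    obtain ⟨t, ht, htS⟩ := hw γ h1
    obtain ⟨s, hs, hsw⟩ := hWS w hwW
    refine hS.achronal s hs _ htS ?_
    rcases h2 t ht with h3 | h3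
    · rwa [← h3]
    · exact hsw.trans h3
  obtain ⟨γ, h1, h2, h3, h4⟩ := exists_inextendible_of_exists_exit (P := IsPastCausal T)
    (W := W) (fun p ↦ by
      obtain ⟨R, K, f, e, h⟩ := exists_isConeChart T p
      have hR := h.pos
      have hRhalf := half_lt_self hR
      obtain ⟨ho, hm⟩ := exists_chart_nhds (n := n) (p := p) (r := R / 4) (by linarith)
      set φ := extChartAt (𝓡 (n + 1)) p with hφ
      have hcl := h.isClosed_closedBall (r := R / 4) (by linarith)
      refine ⟨_, ho, hm, fun x ⟨z, hz, hzx⟩ hxV ↦ ?_⟩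
      -- Three radii are in play: cone curves are controlled up to `R`, entry points lie on the
      -- sphere of radius R/2, and only the ball of radius R/4 has to be left.
      obtain ⟨c, hQc, hcx, hcV⟩ : ∃ c, Q c ∧ ChronologicallyPrecedes T c x ∧
          c ∉ φ.source ∩ φ ⁻¹' Metric.closedBall (φ p) (R / 4) := by
        by_cases hzV : z ∈ φ.source ∩ φ ⁻¹' Metric.ball (φ p) (R / 2)
        swap
        · exact ⟨z, hz, hzx, fun hmem ↦
            hzV ⟨hmem.1, Metric.closedBall_subset_ball (by linarith) hmem.2⟩⟩
        obtain ⟨hzy, b', hb', hab'⟩ := hz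
        obtain ⟨ho', -⟩ := exists_chart_nhds (n := n) (p := p) (half_pos hR)
        have hex : ∀ᶠ i in 𝒰, ∃ c, (c = a i ∨ CausallyPrecedes T (a i) c ∧
            φ c ∉ Metric.ball (φ p) (R / 2)) ∧ c ∈ φ.source ∧
            ∃ σ, IsConeCurve (Metric.ball (φ p) R) (fun z ↦ formCone (chartForm g p z) f) f e K
              (Metric.closedBall (φ p) (R / 2)) (φ c) (φ (b' i)) σ := by
          filter_upwards [hab', hb'.eventually (ho'.mem_nhds hzV)] with i h1 h2
          exact h.exists_isConeCurve_or_exit hRhalf h1 h2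
        choose! c hc1 hc2 σ hσ using fun i (hi : ∃ c, (c = a i ∨ CausallyPrecedes T (a i) c ∧
            φ c ∉ Metric.ball (φ p) (R / 2)) ∧ c ∈ φ.source ∧
            ∃ σ, IsConeCurve (Metric.ball (φ p) R) (fun z ↦ formCone (chartForm g p z) f) f e K
              (Metric.closedBall (φ p) (R / 2)) (φ c) (φ (b' i)) σ) ↦ hi
        have hcball : ∀ᶠ i in 𝒰, φ (c i) ∈ Metric.closedBall (φ p) (R / 2) := by
          filter_upwards [hex] with i hi
          have := (hσ i hi).mem 0 ⟨le_rfl, sub_nonneg.2 (hσ i hi).le⟩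
          rwa [(hσ i hi).left] at this
        obtain ⟨α, hα, hαlim⟩ := (isCompact_closedBall (φ p) (R / 2)).ultrafilter_le_nhds
          (𝒰.map fun i ↦ φ (c i)) (le_principal_iff.2 hcball)
        have hαlim' : Tendsto (fun i ↦ φ (c i)) 𝒰 (𝓝 α) := hαlim
        have hαt : α ∈ φ.target := h.ball_subset (Metric.closedBall_subset_ball hRhalf hα)
        have hclim : Tendsto c 𝒰 (𝓝 (φ.symm α)) := by
          refine ((continuousAt_extChartAt_symm'' hαt).tendsto.comp hαlim').congr' ?_
          filter_upwards [hex] with i hi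
          exact φ.left_inv (hc2 i hi)
        have hbφ : Tendsto (fun i ↦ φ (b' i)) 𝒰 (𝓝 (φ z)) :=
          (continuousAt_extChartAt' hzV.1).tendsto.comp hb'
        obtain ⟨ρ, hρ⟩ := IsConeCurve.exists_of_tendsto h.coneField
          (isCompact_closedBall (φ p) (R / 2)) (hex.mono hσ) hαlim' hbφ
        have hcz : CausallyPrecedes T (φ.symm α) z := by
          have := h.causallyPrecedes_of_isConeCurve hRhalf hρ
          rwa [φ.left_inv hzV.1] at this
        -- One alternative holds for almost all `i`. If the curves start inside, `a` itself
        -- converges to a point below `y`, which was excluded; otherwise the limit of the entry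
        -- points is in `Q`.
        rcases (Ultrafilter.eventually_or (f := 𝒰)).1 (hex.mono hc1) with hA | hB
        · refine absurd ⟨φ.symm α, hclim.congr' hA, hcz.trans hzy⟩ hcon
        · refine ⟨φ.symm α, ⟨hcz.trans hzy, c, hclim, hB.mono fun i hi ↦ hi.1⟩,
            hcz.trans_chronologicallyPrecedes hzx, fun hmem ↦ ?_⟩
          have h5 : α ∉ Metric.ball (φ p) (R / 2) := by
            have := Metric.isOpen_ball.isClosed_compl.mem_of_tendsto hαlim'
              (hB.mono fun i hi ↦ hi.2)
            exact this
          have h6 := hmem.2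
          rw [mem_preimage, φ.right_inv hαt] at h6
          exact h5 (Metric.closedBall_subset_ball (by linarith) h6)
      -- The point `c` need not lie in `W`. A nearby point in its chronological future does, and is
      -- still outside the ball and chronologically before `x`.
      obtain ⟨x', ⟨hx'V, hx'x⟩, hcx'⟩ := exists_mem_chronologicallyPrecedes T (c := c)
        (inter_mem (hcl.isOpen_compl.mem_nhds hcV) ((isOpen_chronologicalPast T x).mem_nhds hcx))
      obtain ⟨δ, h1, h2, h3, h4⟩ := ChronologicallyPrecedes.exists_past_curve hx'x
      refine ⟨x', ⟨c, hQc, hcx'⟩, fun hmem ↦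
        hx'V ⟨hmem.1, Metric.ball_subset_closedBall hmem.2⟩, δ, h1, h2, h3, fun t ht ↦ ?_⟩
      rcases h4 t ht with h5 | h5
      · rw [← h5]
        exact ⟨c, hQc, hcx'⟩
      · exact ⟨c, hQc, hcx'.trans h5⟩) hwW
  obtain ⟨t, ht, htS⟩ := hw γ ⟨h1, h2, h3⟩
  obtain ⟨s, hs, hst⟩ := hWS _ (h4 t ht)
  exact hS.achronal s hs _ htS hst

end Global

end LorentzGeometry

/-! ### Stability of J⁺(S) ∩ J⁻(q) under perturbation of q -/

theorem lemma2 {n : ℕ} {M : Type*} [TopologicalSpace M]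
    [ChartedSpace (EuclideanSpace ℝ (Fin (n + 1))) M] [IsManifold (𝓡 (n + 1)) ∞ M]
    [T2Space M] [SecondCountableTopology M]
    (g : LorentzGeometry.LorentzianMetric n M) (T : LorentzGeometry.TimeOrientation g)
    (S : Set M) (hS : LorentzGeometry.IsCauchySurface T S)
    (hS_smooth : LorentzGeometry.IsSmoothHypersurface n S)
    (U : Set M) (hU : IsOpen U) (q : M)
    (hq : LorentzGeometry.causalFutureSet T S ∩ LorentzGeometry.causalPast T q ⊆ U)
    (u : ℕ → M) (hu : Filter.Tendsto u Filter.atTop (nhds q)) :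
    ∃ i₀ : ℕ, ∀ i ≥ i₀,
      LorentzGeometry.causalFutureSet T S ∩ LorentzGeometry.causalPast T (u i) ⊆ U := by
  by_contra hcon
  have hfreq : ∃ᶠ i in atTop, ¬ LorentzGeometry.causalFutureSet T S ∩
      LorentzGeometry.causalPast T (u i) ⊆ U := fun h ↦
    hcon (eventually_atTop.1 (h.mono fun i hi ↦ not_not.1 hi))
  have : Nonempty M := ⟨q⟩
  have := frequently_iff_neBot.1 hfreq
  -- An ultrafilter concentrated on the bad indices takes the place of successive subsequences.
  obtain ⟨𝒰, h𝒰⟩ := Ultrafilter.exists_le (atTop ⊓ 𝓟 {i | ¬ LorentzGeometry.causalFutureSet T S ∩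
      LorentzGeometry.causalPast T (u i) ⊆ U})
  have hbad := le_principal_iff.1 (h𝒰.trans inf_le_right)
  have hbad' : ∀ᶠ i in (𝒰 : Filter ℕ), ∃ x s, s ∈ S ∧ LorentzGeometry.CausallyPrecedes T s x ∧
      LorentzGeometry.CausallyPrecedes T x (u i) ∧ x ∉ U := by
    filter_upwards [hbad] with i hi
    obtain ⟨x, ⟨hxS, hxu⟩, hxU⟩ := not_subset.1 hi
    obtain ⟨s, hs, hsx⟩ := mem_iUnion₂.1 hxS
    exact ⟨x, s, hs, hsx, hxu, hxU⟩
  choose! x s hs hsx hxu hxU using fun i (hi : ∃ x s, s ∈ S ∧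
    LorentzGeometry.CausallyPrecedes T s x ∧ LorentzGeometry.CausallyPrecedes T x (u i) ∧
      x ∉ U) ↦ hi
  obtain ⟨y, hy, hyq⟩ := hS.exists_tendsto_causallyPrecedes (hu.mono_left (h𝒰.trans inf_le_left)) (hbad'.mono hxu)
    (hbad'.mono fun i hi ↦ ⟨s i, hs i hi, hsx i hi⟩)
  -- The same statement one level lower, for `s i ≤ x i → y`; each `s i` lies in J⁺(S) trivially.
  obtain ⟨z, hz, hzy⟩ := hS.exists_tendsto_causallyPrecedes hy (hbad'.mono hsx)
    (hbad'.mono fun i hi ↦ ⟨s i, hs i hi, Or.inl rfl⟩)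
  have hzS : z ∈ S := hS.isClosed.mem_of_tendsto hz (hbad'.mono hs)
  have hyU : y ∉ U := hU.isClosed_compl.mem_of_tendsto hy (hbad'.mono hxU)
  exact hyU (hq ⟨mem_iUnion₂.2 ⟨z, hzS, hzy⟩, hyq⟩)
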